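/- Let $(M,g)$ be a Lorentz surface (a smooth 2-manifold with a metric of index $1$) with Levi-Civita connection $\nabla$ and curvature $R$. Let $(\tilde M,\tilde g,J)$ be a Lorentzian Kaehler surface: a smooth manifold of real dimension $4$ with an almost complex structure $J$ and an indefinite metric $\tilde g$ such that $\tilde g(JX,JY)=\tilde g(X,Y)$ and $\tilde\nabla J=0$ for the Levi-Civita connection $\tilde\nabla$ of $\tilde g$, and such that the largest $J$-invariant negative definite subspace of each tangent space has complex dimension $1$. Let $\tilde R$ be its curvature. The convention is $R(X,Y)=[\nabla_X,\nabla_Y]-\nabla_{[X,Y]}$. Let $f:M\to\tilde M$ be smooth, let $V\to M$ be a smooth vector bundle of rank $2$, and let $\tau:TM\to f^*T\tilde M$ and $\nu:V\to f^*T\tilde M$ be smooth bundle maps such that $\tilde g(\tau X,\tau Y)=g(X,Y)$, $\nu$ is injective and $\nu(V)\perp\tau(TM)$; thus $f^*T\tilde M=\tau(TM)\oplus\nu(V)$. Given a connection $\hat\nabla$ on $f^*T\tilde M$, let $h$, $A$, $D$ (smooth, $D$ being a connection on $V$) satisfy the formulas of Gauss and Weingarten $$\hat\nabla_X(\tau Y)=\tau(\nabla_XY)+\nu\,h(X,Y),\qquad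 \hat\nabla_X(\nu\xi)=-\tau(A_\xi X)+\nu\,D_X\xi .$$ Write $\langle\xi,\eta\rangle=\tilde g(\nu\xi,\nu\eta)$ and identify tangent vectors $X$ and $\xi\in V$ with $\tau X$ and $\nu\xi$ where they enter $\tilde R$ and $\tilde g$. Consider at a point $x\in M$ the equations of Gauss, Codazzi and Ricci, for all $X,Y,Z,W\in T_xM$ and $\xi,\eta\in V_x$: $$g(R(X,Y)Z,W)=\tilde g(\tilde R(X,Y)Z,W)+\langle h(X,W),h(Y,Z)\rangle-\langle h(X,Z),h(Y,W)\rangle ,\tag{G}$$ $$(\tilde R(X,Y)Z)^\perp=(\bar\nabla_Xh)(Y,Z)-(\bar\nabla_Yh)(X,Z),\tag{C}$$ $$\langle R^D(X,Y)\xi,\eta\rangle=\tilde g(\tilde R(X,Y)\xi,\eta)+g([A_\xi,A_\eta]X,Y),\tag{R}$$ where $R^D$ is the curvature of $D$, $(\cdot)^\perp$ is the component in $V$, and $(\bar\nabla_Xh)(Y,Z)=D_Xh(Y,Z)-h(\nabla_XY,Z)-h(Y,\nabla_XZ)$. The equation of Gauss is a consequence of the equations of Codazzi and Ricci, in both of the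 following situations. (1) $f$ is an isometric immersion with $\tau=df$ (so $V$ is its normal bundle) and $\hat\nabla=f^*\tilde\nabla$ (so $h$, $A$, $D$ are its second fundamental form, shape operator and normal connection): at every point $x\in M$, if (C) and (R) hold at $x$, then (G) holds at $x$. (2) More generally, $\tau$ is arbitrary as above, and $\hat\nabla$ is any connection on $f^*T\tilde M$, not necessarily induced by $\tilde\nabla$, which is metric, satisfies $\hat\nabla J=0$, and is torsion free in the sense that $\hat\nabla_X(\tau Y)-\hat\nabla_Y(\tau X)=\tau[X,Y]$: at every point $x\in M$, if (C) and (R) hold at $x$, then (G) holds at $x$. -/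

import Mathlib

open Bundle
open scoped Manifold ContDiff Topology

noncomputable section

namespace LorentzKaehler

section Connections

variable {E : Type*} [NormedAddCommGroup E] [NormedSpace ℝ E]
  {H : Type*} [TopologicalSpace H] {I : ModelWithCorners ℝ E H}
  {M : Type*} [TopologicalSpace M] [ChartedSpace H M] [IsManifold I ∞ M]

/-- The vector field `X` is smooth at the point `x`. -/
def SmoothFieldAt (X : Π x : M, TangentSpace I x) (x : M) : Prop :=
  ContMDiffAt I (I.prod 𝓘(ℝ, E)) ∞ (fun y ↦ (⟨y, X y⟩ : TangentBundle I M)) x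

section Bundle

variable (F : Type*) [NormedAddCommGroup F] [NormedSpace ℝ F]
  {V : M → Type*} [TopologicalSpace (TotalSpace F V)]
  [∀ x, AddCommGroup (V x)] [∀ x, Module ℝ (V x)] [∀ x, TopologicalSpace (V x)]
  [∀ x, IsTopologicalAddGroup (V x)] [∀ x, ContinuousSMul ℝ (V x)]
  [FiberBundle F V]

variable (I) in
/-- The section `σ` of the vector bundle `V` is smooth at the point `x`. -/
def SmoothSectionAt (σ : Π x : M, V x) (x : M) : Prop :=
  ContMDiffAt I (I.prod 𝓘(ℝ, F)) ∞ (fun y ↦ (⟨y, σ y⟩ : TotalSpace F V)) x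

variable {F}

/-- A connection is smooth if `∇_X σ` is smooth wherever `X` and `σ` are.
Recall that `∇ σ x u` is `∇_u σ` at the point `x`. -/
def IsSmoothConnection (nabla : CovariantDerivative I F V) : Prop :=
  ∀ (σ : Π x : M, V x) (X : Π x : M, TangentSpace I x) (x : M),
    SmoothSectionAt I F σ x → SmoothFieldAt X x →
      SmoothSectionAt I F (fun y ↦ nabla σ y (X y)) x

/-- `∇_X ∇_Y σ - ∇_Y ∇_X σ - ∇_{[X,Y]} σ`. -/
def curvatureField (nabla : CovariantDerivative I F V) (X Y : Π x : M, TangentSpace I x)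
    (σ : Π x : M, V x) (x : M) : V x :=
  nabla (fun y ↦ nabla σ y (Y y)) x (X x) - nabla (fun y ↦ nabla σ y (X y)) x (Y x)
    - nabla σ x (VectorField.mlieBracket I X Y x)

/-- The curvature tensor `R(u, v) s` of a connection at the point `x`, computed by extending the
vectors `u, v, s` at `x` to local smooth sections. -/
def curvature (nabla : CovariantDerivative I F V) (x : M) (u v : TangentSpace I x) (s : V x) :
    V x :=
  curvatureField nabla (FiberBundle.extend E u) (FiberBundle.extend E v)
    (FiberBundle.extend F s) x

end Bundle

/-- A (possibly indefinite) semi-Riemannian metric: a smooth field of nondegenerate symmetric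
bilinear forms on the tangent spaces. -/
structure IsSemiRiemannianMetric
    (g : Π x : M, TangentSpace I x →L[ℝ] TangentSpace I x →L[ℝ] ℝ) : Prop where
  symm : ∀ x (u v : TangentSpace I x), g x u v = g x v u
  nondegenerate : ∀ x (u : TangentSpace I x), (∀ v, g x u v = 0) → u = 0
  smooth : ContMDiff I (I.prod 𝓘(ℝ, E →L[ℝ] E →L[ℝ] ℝ)) ∞
    (fun x ↦ TotalSpace.mk' (E →L[ℝ] E →L[ℝ] ℝ) x (g x))

/-- The form `g` at `x` is negative definite on the subspace `W`. -/
def IsNegativeDefiniteOn (g : Π x : M, TangentSpace I x →L[ℝ] TangentSpace I x →L[ℝ] ℝ) (x : M)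
    (W : Submodule ℝ (TangentSpace I x)) : Prop :=
  ∀ v ∈ W, v ≠ 0 → g x v v < 0

/-- A Lorentzian metric: a semi-Riemannian metric of index one. -/
structure IsLorentzMetric
    (g : Π x : M, TangentSpace I x →L[ℝ] TangentSpace I x →L[ℝ] ℝ) : Prop
    extends IsSemiRiemannianMetric g where
  index_one : ∀ x, IsGreatest {d : ℕ | ∃ W : Submodule ℝ (TangentSpace I x),
    IsNegativeDefiniteOn g x W ∧ Module.finrank ℝ W = d} 1

/-- `∇` is the Levi-Civita connection of `g`: smooth, torsion free and metric. -/
structure IsLeviCivita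
    (g : Π x : M, TangentSpace I x →L[ℝ] TangentSpace I x →L[ℝ] ℝ)
    (nabla : CovariantDerivative I E (TangentSpace I : M → Type _)) : Prop where
  smooth : IsSmoothConnection nabla
  torsion_free : ∀ (X Y : Π x : M, TangentSpace I x) (x : M),
    SmoothFieldAt X x → SmoothFieldAt Y x →
      nabla Y x (X x) - nabla X x (Y x) = VectorField.mlieBracket I X Y x
  metric : ∀ (Y Z : Π x : M, TangentSpace I x) (x : M), SmoothFieldAt Y x → SmoothFieldAt Z x →
    ∀ u : TangentSpace I x, mvfderiv I (fun y ↦ g y (Y y) (Z y)) x u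
      = g x (nabla Y x u) (Z x) + g x (Y x) (nabla Z x u)

/-- `(g, J)` is an indefinite Kaehler structure of complex index one, where `∇` is
the Levi-Civita connection of `g`. -/
structure IsLorentzianKaehler
    (g : Π x : M, TangentSpace I x →L[ℝ] TangentSpace I x →L[ℝ] ℝ)
    (J : Π x : M, TangentSpace I x →L[ℝ] TangentSpace I x)
    (nabla : CovariantDerivative I E (TangentSpace I : M → Type _)) : Prop where
  metric : IsSemiRiemannianMetric g
  smooth : ContMDiff I (I.prod 𝓘(ℝ, E →L[ℝ] E)) ∞ (fun x ↦ TotalSpace.mk' (E →L[ℝ] E) x (J x))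
  almost_complex : ∀ x (u : TangentSpace I x), J x (J x u) = -u
  hermitian : ∀ x (u v : TangentSpace I x), g x (J x u) (J x v) = g x u v
  levi_civita : IsLeviCivita g nabla
  parallel : ∀ (Y : Π x : M, TangentSpace I x) (x : M), SmoothFieldAt Y x →
    ∀ u : TangentSpace I x, nabla (fun y ↦ J y (Y y)) x u = J x (nabla Y x u)
  complex_index_one : ∀ x, IsGreatest {d : ℕ | ∃ W : Submodule ℝ (TangentSpace I x),
    (∀ v ∈ W, J x v ∈ W) ∧ IsNegativeDefiniteOn g x W ∧ Module.finrank ℝ W = 2 * d} 1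

end Connections

section Surfaces

/-- The model space of real dimension `n`. -/
abbrev R (n : ℕ) : Type := EuclideanSpace ℝ (Fin n)

variable {M : Type*} [TopologicalSpace M] [ChartedSpace (R 2) M] [IsManifold (𝓡 2) ∞ M]
  {N : Type*} [TopologicalSpace N] [ChartedSpace (R 4) N] [IsManifold (𝓡 4) ∞ N]
  {V : M → Type*} [TopologicalSpace (TotalSpace (R 2) V)]
  [∀ x, AddCommGroup (V x)] [∀ x, Module ℝ (V x)] [∀ x, TopologicalSpace (V x)]
  [∀ x, IsTopologicalAddGroup (V x)] [∀ x, ContinuousSMul ℝ (V x)]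
  [FiberBundle (R 2) V]

/-- The vector field `s` along the map `f : M → N` is smooth at `x`. -/
def SmoothAlongAt (f : M → N) (s : Π x : M, TangentSpace (𝓡 4) (f x)) (x : M) : Prop :=
  ContMDiffAt (𝓡 2) ((𝓡 4).prod 𝓘(ℝ, R 4)) ∞
    (fun y ↦ (⟨f y, s y⟩ : TangentBundle (𝓡 4) N)) x

/-- An isometric splitting `TM ⊕ V = f^*TN` along a smooth map `f : M → N`: `τ` embeds `TM`
isometrically, and `ν` identifies `V`, which has rank two, with the orthogonal complement of
`τ (TM)`. When `τ` is the differential of `f`, this says that `f` is an isometric immersion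
with normal bundle `V`. -/
structure IsSplitting (g : Π x : M, TangentSpace (𝓡 2) x →L[ℝ] TangentSpace (𝓡 2) x →L[ℝ] ℝ)
    (gN : Π y : N, TangentSpace (𝓡 4) y →L[ℝ] TangentSpace (𝓡 4) y →L[ℝ] ℝ)
    (f : M → N) (τ : Π x : M, TangentSpace (𝓡 2) x →L[ℝ] TangentSpace (𝓡 4) (f x))
    (ν : Π x : M, V x →L[ℝ] TangentSpace (𝓡 4) (f x)) : Prop where
  smooth_map : ContMDiff (𝓡 2) (𝓡 4) ∞ f
  smooth_tangent : ∀ (X : Π x : M, TangentSpace (𝓡 2) x) (x : M), SmoothFieldAt X x →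
    SmoothAlongAt f (fun y ↦ τ y (X y)) x
  smooth_normal : ∀ (ξ : Π x : M, V x) (x : M), SmoothSectionAt (𝓡 2) (R 2) ξ x →
    SmoothAlongAt f (fun y ↦ ν y (ξ y)) x
  isometric : ∀ x (u v : TangentSpace (𝓡 2) x), gN (f x) (τ x u) (τ x v) = g x u v
  orthogonal : ∀ x (u : TangentSpace (𝓡 2) x) (ξ : V x), gN (f x) (τ x u) (ν x ξ) = 0
  injective : ∀ x, Function.Injective (ν x)

/-- A smooth connection on `f^*TN`; `nab s x u` is the covariant derivative at `x`
in the direction `u` of the vector field `s` along `f`. -/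
structure IsConnectionAlong (f : M → N)
    (nab : (Π x : M, TangentSpace (𝓡 4) (f x)) →
      Π x : M, TangentSpace (𝓡 2) x →L[ℝ] TangentSpace (𝓡 4) (f x)) : Prop where
  add : ∀ (s t : Π x : M, TangentSpace (𝓡 4) (f x)) (x : M),
    SmoothAlongAt f s x → SmoothAlongAt f t x →
      nab (fun y ↦ s y + t y) x = nab s x + nab t x
  leibniz : ∀ (φ : M → ℝ) (s : Π x : M, TangentSpace (𝓡 4) (f x)) (x : M),
    ContMDiffAt (𝓡 2) 𝓘(ℝ, ℝ) ∞ φ x → SmoothAlongAt f s x →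
      ∀ u : TangentSpace (𝓡 2) x,
        nab (fun y ↦ φ y • s y) x u = φ x • nab s x u + mvfderiv (𝓡 2) φ x u • s x
  smooth : ∀ (s : Π x : M, TangentSpace (𝓡 4) (f x)) (X : Π x : M, TangentSpace (𝓡 2) x) (x : M),
    SmoothAlongAt f s x → SmoothFieldAt X x → SmoothAlongAt f (fun y ↦ nab s y (X y)) x

/-- `nab` is the connection on `f^*TN` induced by the connection `nablaN` of `N`. -/
structure IsPullbackConnection (nablaN : CovariantDerivative (𝓡 4) (R 4)
      (TangentSpace (𝓡 4) : N → Type _)) (f : M → N)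
    (nab : (Π x : M, TangentSpace (𝓡 4) (f x)) →
      Π x : M, TangentSpace (𝓡 2) x →L[ℝ] TangentSpace (𝓡 4) (f x)) : Prop
    extends IsConnectionAlong f nab where
  comp : ∀ (Z : Π y : N, TangentSpace (𝓡 4) y) (x : M), SmoothFieldAt Z (f x) →
    ∀ u : TangentSpace (𝓡 2) x,
      nab (fun y ↦ Z (f y)) x u = nablaN Z (f x) (mfderiv (𝓡 2) (𝓡 4) f x u)

/-- A Kaehler connection on `f^*TN`: metric, with `J` parallel, and torsion free with respect to
`τ : TM → f^*TN`. It is *not* required to be induced by the connection of `N`. -/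
structure IsKaehlerConnectionAlong
    (gN : Π y : N, TangentSpace (𝓡 4) y →L[ℝ] TangentSpace (𝓡 4) y →L[ℝ] ℝ)
    (J : Π y : N, TangentSpace (𝓡 4) y →L[ℝ] TangentSpace (𝓡 4) y)
    (f : M → N) (τ : Π x : M, TangentSpace (𝓡 2) x →L[ℝ] TangentSpace (𝓡 4) (f x))
    (nab : (Π x : M, TangentSpace (𝓡 4) (f x)) →
      Π x : M, TangentSpace (𝓡 2) x →L[ℝ] TangentSpace (𝓡 4) (f x)) : Prop
    extends IsConnectionAlong f nab where
  metric : ∀ (s t : Π x : M, TangentSpace (𝓡 4) (f x)) (x : M),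
    SmoothAlongAt f s x → SmoothAlongAt f t x → ∀ u : TangentSpace (𝓡 2) x,
      mvfderiv (𝓡 2) (fun y ↦ gN (f y) (s y) (t y)) x u
        = gN (f x) (nab s x u) (t x) + gN (f x) (s x) (nab t x u)
  parallel : ∀ (s : Π x : M, TangentSpace (𝓡 4) (f x)) (x : M), SmoothAlongAt f s x →
    ∀ u : TangentSpace (𝓡 2) x, nab (fun y ↦ J (f y) (s y)) x u = J (f x) (nab s x u)
  torsion_free : ∀ (X Y : Π x : M, TangentSpace (𝓡 2) x) (x : M),
    SmoothFieldAt X x → SmoothFieldAt Y x →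
      nab (fun y ↦ τ y (Y y)) x (X x) - nab (fun y ↦ τ y (X y)) x (Y x)
        = τ x (VectorField.mlieBracket (𝓡 2) X Y x)

/-- The formulas of Gauss and Weingarten, which decompose the connection `nab` of `f^*TN` into the
connection `nabla` of `M`, the second fundamental form `h`, the shape operator `A`
(`A x ξ u` is `A_ξ u`) and the normal connection `D`. -/
structure GaussWeingarten
    (nabla : CovariantDerivative (𝓡 2) (R 2) (TangentSpace (𝓡 2) : M → Type _))
    (f : M → N) (τ : Π x : M, TangentSpace (𝓡 2) x →L[ℝ] TangentSpace (𝓡 4) (f x))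
    (ν : Π x : M, V x →L[ℝ] TangentSpace (𝓡 4) (f x))
    (nab : (Π x : M, TangentSpace (𝓡 4) (f x)) →
      Π x : M, TangentSpace (𝓡 2) x →L[ℝ] TangentSpace (𝓡 4) (f x))
    (h : Π x : M, TangentSpace (𝓡 2) x →L[ℝ] TangentSpace (𝓡 2) x →L[ℝ] V x)
    (A : Π x : M, V x →L[ℝ] TangentSpace (𝓡 2) x →L[ℝ] TangentSpace (𝓡 2) x)
    (D : CovariantDerivative (𝓡 2) (R 2) V) : Prop where
  smooth_h : ∀ (X Y : Π x : M, TangentSpace (𝓡 2) x) (x : M),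
    SmoothFieldAt X x → SmoothFieldAt Y x →
      SmoothSectionAt (𝓡 2) (R 2) (fun y ↦ h y (X y) (Y y)) x
  smooth_A : ∀ (ξ : Π x : M, V x) (X : Π x : M, TangentSpace (𝓡 2) x) (x : M),
    SmoothSectionAt (𝓡 2) (R 2) ξ x → SmoothFieldAt X x →
      SmoothFieldAt (fun y ↦ A y (ξ y) (X y)) x
  smooth_D : IsSmoothConnection D
  gauss : ∀ (Y : Π x : M, TangentSpace (𝓡 2) x) (x : M), SmoothFieldAt Y x →
    ∀ u : TangentSpace (𝓡 2) x,
      nab (fun y ↦ τ y (Y y)) x u = τ x (nabla Y x u) + ν x (h x u (Y x))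
  weingarten : ∀ (ξ : Π x : M, V x) (x : M), SmoothSectionAt (𝓡 2) (R 2) ξ x →
    ∀ u : TangentSpace (𝓡 2) x,
      nab (fun y ↦ ν y (ξ y)) x u = -τ x (A x (ξ x) u) + ν x (D ξ x u)

/-- `(∇̄_u h)(v, w) = D_u h(v, w) - h(∇_u v, w) - h(v, ∇_u w)` at `x`, where `v` and `w` are
extended to local smooth vector fields. -/
def covDerivSecondForm
    (nabla : CovariantDerivative (𝓡 2) (R 2) (TangentSpace (𝓡 2) : M → Type _))
    (h : Π x : M, TangentSpace (𝓡 2) x →L[ℝ] TangentSpace (𝓡 2) x →L[ℝ] V x)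
    (D : CovariantDerivative (𝓡 2) (R 2) V) (x : M) (u v w : TangentSpace (𝓡 2) x) : V x :=
  D (fun y ↦ h y (FiberBundle.extend (R 2) v y) (FiberBundle.extend (R 2) w y)) x u
    - h x (nabla (FiberBundle.extend (R 2) v) x u) w
    - h x v (nabla (FiberBundle.extend (R 2) w) x u)

/-- The equation of Gauss at the point `x`. -/
def GaussEquationAt (g : Π x : M, TangentSpace (𝓡 2) x →L[ℝ] TangentSpace (𝓡 2) x →L[ℝ] ℝ)
    (nabla : CovariantDerivative (𝓡 2) (R 2) (TangentSpace (𝓡 2) : M → Type _))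
    (gN : Π y : N, TangentSpace (𝓡 4) y →L[ℝ] TangentSpace (𝓡 4) y →L[ℝ] ℝ)
    (nablaN : CovariantDerivative (𝓡 4) (R 4) (TangentSpace (𝓡 4) : N → Type _))
    (f : M → N) (τ : Π x : M, TangentSpace (𝓡 2) x →L[ℝ] TangentSpace (𝓡 4) (f x))
    (ν : Π x : M, V x →L[ℝ] TangentSpace (𝓡 4) (f x))
    (h : Π x : M, TangentSpace (𝓡 2) x →L[ℝ] TangentSpace (𝓡 2) x →L[ℝ] V x) (x : M) : Prop :=
  ∀ X Y Z W : TangentSpace (𝓡 2) x,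
    g x (curvature nabla x X Y Z) W
      = gN (f x) (curvature nablaN (f x) (τ x X) (τ x Y) (τ x Z)) (τ x W)
        + gN (f x) (ν x (h x X W)) (ν x (h x Y Z))
        - gN (f x) (ν x (h x X Z)) (ν x (h x Y W))

/-- The equation of Codazzi at the point `x`: the component in `V` of `R̃(X, Y) Z` is
`(∇̄_X h)(Y, Z) - (∇̄_Y h)(X, Z)`, that is, they differ by a tangent vector. -/
def CodazziEquationAt
    (nabla : CovariantDerivative (𝓡 2) (R 2) (TangentSpace (𝓡 2) : M → Type _))
    (nablaN : CovariantDerivative (𝓡 4) (R 4) (TangentSpace (𝓡 4) : N → Type _))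
    (f : M → N) (τ : Π x : M, TangentSpace (𝓡 2) x →L[ℝ] TangentSpace (𝓡 4) (f x))
    (ν : Π x : M, V x →L[ℝ] TangentSpace (𝓡 4) (f x))
    (h : Π x : M, TangentSpace (𝓡 2) x →L[ℝ] TangentSpace (𝓡 2) x →L[ℝ] V x)
    (D : CovariantDerivative (𝓡 2) (R 2) V) (x : M) : Prop :=
  ∀ X Y Z : TangentSpace (𝓡 2) x, ∃ T : TangentSpace (𝓡 2) x,
    curvature nablaN (f x) (τ x X) (τ x Y) (τ x Z)
      = τ x T + ν x (covDerivSecondForm nabla h D x X Y Z - covDerivSecondForm nabla h D x Y X Z)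

/-- The equation of Ricci at the point `x`. -/
def RicciEquationAt (g : Π x : M, TangentSpace (𝓡 2) x →L[ℝ] TangentSpace (𝓡 2) x →L[ℝ] ℝ)
    (gN : Π y : N, TangentSpace (𝓡 4) y →L[ℝ] TangentSpace (𝓡 4) y →L[ℝ] ℝ)
    (nablaN : CovariantDerivative (𝓡 4) (R 4) (TangentSpace (𝓡 4) : N → Type _))
    (f : M → N) (τ : Π x : M, TangentSpace (𝓡 2) x →L[ℝ] TangentSpace (𝓡 4) (f x))
    (ν : Π x : M, V x →L[ℝ] TangentSpace (𝓡 4) (f x))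
    (A : Π x : M, V x →L[ℝ] TangentSpace (𝓡 2) x →L[ℝ] TangentSpace (𝓡 2) x)
    (D : CovariantDerivative (𝓡 2) (R 2) V) (x : M) : Prop :=
  ∀ (X Y : TangentSpace (𝓡 2) x) (ξ η : V x),
    gN (f x) (ν x (curvature D x X Y ξ)) (ν x η)
      = gN (f x) (curvature nablaN (f x) (τ x X) (τ x Y) (ν x ξ)) (ν x η)
        + g x (A x ξ (A x η X) - A x η (A x ξ X)) Y

end Surfaces

end LorentzKaehler

end

/-! Fix `X`, `Y` at `x` and let `L` be the curvature of the connection on `f^*TN` in the directions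
`X`, `Y`, minus the curvature of `N` in the directions `τ X`, `τ Y`. Both connections are metric
with `J` parallel, so `L` is a skew-adjoint endomorphism of `T_{f x} N` that commutes with `J`. By
the formulas of Gauss and Weingarten, each of the three equations says that one block of `L`
vanishes for the splitting `τ(TM) ⊕ ν(V)`: Codazzi the tangent-to-normal block, Ricci the
normal-to-normal block, Gauss the tangent-to-tangent block.

Suppose the first two vanish. By skewness `L` kills `ν(V)`, hence also `J ν(V)`. If `J ν(V)` were
contained in `ν(V)`, then `τ(TM)` would be `J`-invariant too; but on a Lorentz plane a negative
vector `u` and `J u` would be orthogonal and both negative, against index one. So some `J ν ξ` has a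
nonzero tangential part `τ u`, and `τ u = J ν ξ - ν η` is killed by `L`. The form `(Z, W) ↦ ⟨L τ Z,
τ W⟩` is skew on a plane and has `u` in its kernel, so it vanishes, which is the equation of Gauss.
This is `skew_eq_zero_of_commute_of_index_one`.

The rest supplies its hypotheses. The symmetries of curvature are `bilin_curvatureAlong` and
`curvatureAlong_endo`, and its tensoriality is `curvatureAlong_pointwise`; they are proved for a
connection along any map, so that they serve `f` and the identity of `N` alike. The blocks are
computed in `curvatureAlong_tangent`, `curvatureAlong_normal` and `shape_operator`. An isometric
immersion is the case `τ = df`, once the pullback connection is known to be metric, complex and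
torsion free. -/

namespace LorentzKaehler

/-! ### Lie brackets as commutators of derivations. -/

section LieBracketAction

variable {E : Type*} [NormedAddCommGroup E] [NormedSpace ℝ E]
  {H : Type*} [TopologicalSpace H] {I : ModelWithCorners ℝ E H}
  {M : Type*} [TopologicalSpace M] [ChartedSpace H M]

theorem _root_.Filter.EventuallyEq.mvfderiv_eq {φ ψ : M → ℝ} {x : M} (h : φ =ᶠ[𝓝 x] ψ) :
    mvfderiv I φ x = mvfderiv I ψ x := by
  ext u
  exact DFunLike.congr_fun (h.mfderiv_eq (I := I) (I' := 𝓘(ℝ, ℝ))) u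

variable [IsManifold I ∞ M]

/-- The derivative of a smooth function along a smooth vector field is smooth. -/
theorem contMDiffAt_mvfderiv_apply {φ : M → ℝ} {X : Π x : M, TangentSpace I x} {x : M}
    (hφ : ContMDiffAt I 𝓘(ℝ, ℝ) ∞ φ x) (hX : SmoothFieldAt X x) :
    ContMDiffAt I 𝓘(ℝ, ℝ) ∞ (fun y ↦ mvfderiv I φ y (X y)) x := by
  have : IsManifold I 1 M := IsManifold.of_le (n := ∞) (by simp)
  have h1 := hφ.mfderiv_const (m := ∞) (by simp)
  have h2 : ContMDiffAt I (𝓘(ℝ, ℝ).prod 𝓘(ℝ, ℝ)) ∞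
      (fun y ↦ (⟨φ y, mfderiv I 𝓘(ℝ, ℝ) φ y (X y)⟩ : TangentBundle 𝓘(ℝ, ℝ) ℝ)) x :=
    ContMDiffAt.clm_apply_of_inCoordinates h1 hX hφ
  exact (contMDiff_snd_tangentBundle_modelSpace ℝ 𝓘(ℝ, ℝ)).contMDiffAt.comp x h2

/-- The Lie bracket of smooth vector fields is smooth. -/
theorem SmoothFieldAt.mlieBracket [CompleteSpace E] {X Y : Π x : M, TangentSpace I x} {x : M}
    (hX : SmoothFieldAt X x) (hY : SmoothFieldAt Y x) :
    SmoothFieldAt (VectorField.mlieBracket I X Y) x := by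
  have le2 : (2 : WithTop ℕ∞) ≤ ∞ := ENat.LEInfty.out
  have : IsManifold I (minSmoothness ℝ 2) M :=
    IsManifold.of_le (n := ∞) (by simpa using le2)
  have : IsManifold I (((⊤ : ℕ∞) : WithTop ℕ∞) + 1) M := IsManifold.of_le (n := ∞) (by simp)
  exact ContMDiffAt.mlieBracket_vectorField (m := ⊤) (n := ⊤) hX hY (by simp)

theorem SmoothFieldAt.mdifferentiableAt {X : Π x : M, TangentSpace I x} {x : M}
    (hX : SmoothFieldAt X x) :
    MDifferentiableAt I (I.prod 𝓘(ℝ, E)) (fun y ↦ (⟨y, X y⟩ : TangentBundle I M)) x :=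
  ContMDiffAt.mdifferentiableAt hX (by simp)

theorem eventually_smoothFieldAt_extend {x : M} (u : TangentSpace I x) :
    ∀ᶠ y in 𝓝 x, SmoothFieldAt (I := I) (FiberBundle.extend E u) y := by
  have : ContMDiffVectorBundle ∞ E (TangentSpace I : M → Type _) I := inferInstance
  obtain ⟨s, hs, h⟩ := FiberBundle.exists_contMDiffOn_extend (k := ∞) I E u
  filter_upwards [eventually_mem_nhds_iff.2 hs] with y hy using h.contMDiffAt hy

/-- The Lie bracket of vector fields acts on functions as a commutator. -/
theorem mvfderiv_mlieBracket [CompleteSpace E] {φ : M → ℝ} {X Y : Π x : M, TangentSpace I x} {x : M}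
    (hφ : ∀ᶠ y in 𝓝 x, ContMDiffAt I 𝓘(ℝ, ℝ) ∞ φ y) (hX : SmoothFieldAt X x)
    (hY : SmoothFieldAt Y x) :
    mvfderiv I φ x (VectorField.mlieBracket I X Y x)
      = mvfderiv I (fun y ↦ mvfderiv I φ y (Y y)) x (X x)
        - mvfderiv I (fun y ↦ mvfderiv I φ y (X y)) x (Y x) := by
  have : IsManifold I (minSmoothness ℝ 3) M := IsManifold.of_le (n := ∞) 
    (by simpa using (ENat.LEInfty.out : (3 : WithTop ℕ∞) ≤ ∞))
  have le2 : minSmoothness ℝ 2 ≤ ∞ := by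
    simpa using (ENat.LEInfty.out : (2 : WithTop ℕ∞) ≤ ∞)
  rcases subsingleton_or_nontrivial E with hE | hE
  · have : Subsingleton (TangentSpace I x) := hE
    rw [Subsingleton.elim (VectorField.mlieBracket I X Y x) 0, Subsingleton.elim (X x) 0,
      Subsingleton.elim (Y x) 0]
    simp
  have : Nontrivial (TangentSpace I x) := hE
  -- The Jacobi identity is applied to `X`, `Y` and `φ • Z`, where `Z` does not vanish at `x`. The
  -- first order terms in `φ` are symmetric in `X` and `Y` and cancel, the terms with
  -- undifferentiated `φ` cancel by the Jacobi identity for `X`, `Y`, `Z`, and the coefficient of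
  -- `z` is the claim.
  obtain ⟨z, hz⟩ := exists_ne (0 : TangentSpace I x)
  set Z : Π y : M, TangentSpace I y := FiberBundle.extend E z with hZdef
  have hZ := eventually_smoothFieldAt_extend z
  rw [← hZdef] at hZ
  have hφx := hφ.self_of_nhds
  have md {ψ : M → ℝ} {y : M} (h : ContMDiffAt I 𝓘(ℝ, ℝ) ∞ ψ y) :
    MDifferentiableAt I 𝓘(ℝ, ℝ) ψ y := h.mdifferentiableAt (by simp)
  have expand (U W : Π y : M, TangentSpace I y) (hU : SmoothFieldAt U x) (hW : SmoothFieldAt W x) :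
      VectorField.mlieBracket I W (VectorField.mlieBracket I U (φ • Z)) x
        = mvfderiv I (fun y ↦ mvfderiv I φ y (U y)) x (W x) • z
          + mvfderiv I φ x (U x) • VectorField.mlieBracket I W Z x
          + (mvfderiv I φ x (W x) • VectorField.mlieBracket I U Z x
          + φ x • VectorField.mlieBracket I W (VectorField.mlieBracket I U Z) x) := by
    have e : VectorField.mlieBracket I U (φ • Z) =ᶠ[𝓝 x]
        (fun y ↦ mvfderiv I φ y (U y)) • Z + φ • VectorField.mlieBracket I U Z := by
      filter_upwards [hφ, hZ] with y h1 h2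
      exact VectorField.mlieBracket_smul_right (md h1) h2.mdifferentiableAt
    have hUφ := contMDiffAt_mvfderiv_apply hφx hU
    have hUZ := hU.mlieBracket hZ.self_of_nhds
    rw [Filter.EventuallyEq.mlieBracket_vectorField_eq (Filter.EventuallyEq.refl _ W) e,
      VectorField.mlieBracket_add_right, VectorField.mlieBracket_smul_right (md hUφ)
        hZ.self_of_nhds.mdifferentiableAt,
      VectorField.mlieBracket_smul_right (md hφx) hUZ.mdifferentiableAt]
    · simp [Z]
    · exact ContMDiffAt.mdifferentiableAt (hUφ.smul_section hZ.self_of_nhds) (by simp)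
    · exact ContMDiffAt.mdifferentiableAt (hφx.smul_section hUZ) (by simp)
  have j1 := VectorField.leibniz_identity_mlieBracket_apply
    (ContMDiffAt.of_le hX le2) (ContMDiffAt.of_le hY le2)
    (ContMDiffAt.of_le (hφx.smul_section hZ.self_of_nhds) le2)
  have j2 := VectorField.leibniz_identity_mlieBracket_apply
    (ContMDiffAt.of_le hX le2) (ContMDiffAt.of_le hY le2)
    (ContMDiffAt.of_le hZ.self_of_nhds le2)
  rw [expand Y X hY hX, expand X Y hX hY, VectorField.mlieBracket_smul_right (md hφx)
    hZ.self_of_nhds.mdifferentiableAt, j2] at j1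
  have hZx : Z x = z := by simp [Z]
  rw [hZx] at j1
  have key : (mvfderiv I φ x (VectorField.mlieBracket I X Y x)
      - (mvfderiv I (fun y ↦ mvfderiv I φ y (Y y)) x (X x)
        - mvfderiv I (fun y ↦ mvfderiv I φ y (X y)) x (Y x))) • z = 0 := by
    rw [smul_add] at j1
    rw [sub_smul, sub_smul, ← neg_eq_zero, ← sub_eq_zero.2 j1]
    abel
  exact sub_eq_zero.1 ((smul_eq_zero.1 key).resolve_right hz)

end LieBracketAction

/-! ### Smooth sections along a map. -/

section Along

variable {E : Type*} [NormedAddCommGroup E] [NormedSpace ℝ E]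
  {H : Type*} [TopologicalSpace H] {I : ModelWithCorners ℝ E H}
  {M : Type*} [TopologicalSpace M] [ChartedSpace H M]
  {E' : Type*} [NormedAddCommGroup E'] [NormedSpace ℝ E']
  {H' : Type*} [TopologicalSpace H'] {I' : ModelWithCorners ℝ E' H'}
  {N : Type*} [TopologicalSpace N] [ChartedSpace H' N]
  {F : Type*} [NormedAddCommGroup F] [NormedSpace ℝ F]
  {W : N → Type*} [TopologicalSpace (TotalSpace F W)]
  [∀ y, TopologicalSpace (W y)] [FiberBundle F W]

variable (I I' F) in
/-- The section `s` of the vector bundle `W` along the map `f` is smooth at `x`. -/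
def SmoothSectionAlongAt (f : M → N) (s : Π x : M, W (f x)) (x : M) : Prop :=
  ContMDiffAt I (I'.prod 𝓘(ℝ, F)) ∞ (fun y ↦ (⟨f y, s y⟩ : TotalSpace F W)) x

theorem SmoothSectionAlongAt.congr {f : M → N} {s t : Π x : M, W (f x)} {x : M}
    (hs : SmoothSectionAlongAt I I' F f s x) (h : ∀ᶠ y in 𝓝 x, t y = s y) :
    SmoothSectionAlongAt I I' F f t x :=
  ContMDiffAt.congr_of_eventuallyEq hs (h.mono fun y hy ↦ by simp [hy])

theorem SmoothSectionAlongAt.base {f : M → N} {s : Π x : M, W (f x)} {x : M}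
    (hs : SmoothSectionAlongAt I I' F f s x) : ContMDiffAt I I' ∞ f x :=
  (contMDiffAt_totalSpace.1 hs).1

theorem smoothSectionAlongAt_comp {f : M → N} {Z : Π y : N, W y} {x : M}
    (hf : ContMDiffAt I I' ∞ f x)
    (hZ : ContMDiffAt I' (I'.prod 𝓘(ℝ, F)) ∞ (fun y ↦ (⟨y, Z y⟩ : TotalSpace F W)) (f x)) :
    SmoothSectionAlongAt I I' F f (fun y ↦ Z (f y)) x :=
  ContMDiffAt.comp x hZ hf

variable [∀ y, AddCommGroup (W y)] [∀ y, Module ℝ (W y)] [VectorBundle ℝ F W]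

/-- Smoothness of a section along a map, read in a local trivialization. -/
theorem smoothSectionAlongAt_iff {f : M → N} {s : Π x : M, W (f x)} {x : M} :
    SmoothSectionAlongAt I I' F f s x ↔ ContMDiffAt I I' ∞ f x ∧
      ContMDiffAt I 𝓘(ℝ, F) ∞
        (fun y ↦ (trivializationAt F W (f x)).continuousLinearMapAt ℝ (f y) (s y)) x := by
  rw [SmoothSectionAlongAt, contMDiffAt_totalSpace]
  refine and_congr_right fun hf ↦ ?_
  have ev : ∀ᶠ y in 𝓝 x, f y ∈ (trivializationAt F W (f x)).baseSet :=
    hf.continuousAt.eventually_mem ((trivializationAt F W (f x)).open_baseSet.mem_nhds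
      (FiberBundle.mem_baseSet_trivializationAt' _))
  refine Filter.EventuallyEq.contMDiffAt_iff ?_
  filter_upwards [ev] with y hy
  rw [Trivialization.continuousLinearMapAt_apply, Trivialization.linearMapAt_apply, if_pos hy]

variable {f : M → N} {s t : Π x : M, W (f x)} {φ : M → ℝ} {x : M}

theorem SmoothSectionAlongAt.add (hs : SmoothSectionAlongAt I I' F f s x)
    (ht : SmoothSectionAlongAt I I' F f t x) :
    SmoothSectionAlongAt I I' F f (fun y ↦ s y + t y) x := by
  rw [smoothSectionAlongAt_iff] at *
  simpa only [map_add] using ⟨hs.1, hs.2.add ht.2⟩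

theorem SmoothSectionAlongAt.smul (hφ : ContMDiffAt I 𝓘(ℝ, ℝ) ∞ φ x)
    (hs : SmoothSectionAlongAt I I' F f s x) :
    SmoothSectionAlongAt I I' F f (fun y ↦ φ y • s y) x := by
  rw [smoothSectionAlongAt_iff] at *
  simpa only [map_smul] using ⟨hs.1, hφ.smul hs.2⟩

theorem SmoothSectionAlongAt.zero (hf : ContMDiffAt I I' ∞ f x) :
    SmoothSectionAlongAt I I' F f (fun y ↦ (0 : W (f y))) x := by
  rw [smoothSectionAlongAt_iff]
  simpa only [map_zero] using ⟨hf, contMDiffAt_const⟩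

theorem SmoothSectionAlongAt.neg (hs : SmoothSectionAlongAt I I' F f s x) :
    SmoothSectionAlongAt I I' F f (fun y ↦ - s y) x := by
  simpa using hs.smul (φ := fun _ ↦ (-1 : ℝ)) contMDiffAt_const

theorem SmoothSectionAlongAt.sum (hf : ContMDiffAt I I' ∞ f x) {ι : Type*} (T : Finset ι)
    {σ : ι → Π x : M, W (f x)}
    (hσ : ∀ i ∈ T, SmoothSectionAlongAt I I' F f (σ i) x) :
    SmoothSectionAlongAt I I' F f (fun y ↦ ∑ i ∈ T, σ i y) x := by
  classical
  induction T using Finset.induction_on with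
  | empty => simpa using SmoothSectionAlongAt.zero hf
  | insert a T ha ih =>
    simp only [Finset.sum_insert ha]
    exact (hσ a (by simp)).add (ih fun i hi ↦ hσ i (by simp [hi]))

/-- A bundle metric evaluated on smooth sections along a map is smooth. -/
theorem SmoothSectionAlongAt.bilin [ContMDiffVectorBundle ∞ F W I']
    [∀ y, IsTopologicalAddGroup (W y)] [∀ y, ContinuousSMul ℝ (W y)]
    {g : Π y : N, W y →L[ℝ] W y →L[ℝ] ℝ}
    (hg : ContMDiff I' (I'.prod 𝓘(ℝ, F →L[ℝ] F →L[ℝ] ℝ)) ∞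
      (fun y ↦ TotalSpace.mk' (F →L[ℝ] F →L[ℝ] ℝ) (E := fun y ↦ W y →L[ℝ] W y →L[ℝ] ℝ) y (g y)))
    (hs : SmoothSectionAlongAt I I' F f s x) (ht : SmoothSectionAlongAt I I' F f t x) :
    ContMDiffAt I 𝓘(ℝ, ℝ) ∞ (fun y ↦ g (f y) (s y) (t y)) x := by
  have h1 := (hg (f x)).comp x hs.base
  have h2 : ContMDiffAt I (I'.prod 𝓘(ℝ, ℝ)) ∞
      (fun m ↦ TotalSpace.mk' ℝ (E := Bundle.Trivial N ℝ) (f m) (g (f m) (s m) (t m))) x :=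
    ContMDiffAt.clm_bundle_apply₂ h1 hs ht
  exact (contMDiffAt_totalSpace.1 h2).2

/-- A smooth bundle endomorphism maps smooth sections along a map to smooth sections. -/
theorem SmoothSectionAlongAt.endo [ContMDiffVectorBundle ∞ F W I']
    [∀ y, IsTopologicalAddGroup (W y)] [∀ y, ContinuousSMul ℝ (W y)]
    {J : Π y : N, W y →L[ℝ] W y}
    (hJ : ContMDiff I' (I'.prod 𝓘(ℝ, F →L[ℝ] F)) ∞
      (fun y ↦ TotalSpace.mk' (F →L[ℝ] F) (E := fun y ↦ W y →L[ℝ] W y) y (J y)))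
    (hs : SmoothSectionAlongAt I I' F f s x) :
    SmoothSectionAlongAt I I' F f (fun y ↦ J (f y) (s y)) x :=
  ContMDiffAt.clm_bundle_apply ((hJ (f x)).comp x hs.base) hs

variable [ContMDiffVectorBundle ∞ F W I'] [FiniteDimensional ℝ F]

/-- Near `x`, a section along `f` is a combination of smooth sections of the bundle over the
target, with coefficients that are linear in the section and smooth where the section is. -/
theorem exists_frame (f : M → N) (x : M) :
    ∃ (n : ℕ) (Z : Fin n → Π y : N, W y) (c : Fin n → Π y : N, W y → ℝ) (U : Set N),
      U ∈ 𝓝 (f x) ∧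
      (∀ i, ∀ y ∈ U, ContMDiffAt I' (I'.prod 𝓘(ℝ, F)) ∞
        (fun y ↦ (⟨y, Z i y⟩ : TotalSpace F W)) y) ∧
      (∀ (s : Π x : M, W (f x)) (x' : M), f x' ∈ U → SmoothSectionAlongAt I I' F f s x' →
        ∀ i, ContMDiffAt I 𝓘(ℝ, ℝ) ∞ (fun y ↦ c i (f y) (s y)) x') ∧
      ∀ y ∈ U, ∀ w : W y, w = ∑ i, c i y w • Z i y := by
  let b := Module.finBasis ℝ F
  let e := trivializationAt F W (f x)
  refine ⟨_, e.localFrame b, fun i y w ↦ b.repr (e ⟨y, w⟩).2 i, e.baseSet,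
    e.open_baseSet.mem_nhds (FiberBundle.mem_baseSet_trivializationAt' _), ?_, ?_, ?_⟩
  · intro i y hy
    exact contMDiffAt_localFrame_of_mem _ e b i hy
  · intro s x' hx' hs i
    have h1 := ((e.contMDiffAt_iff (by simpa [e.mem_source] using hx')).1 hs).2
    exact (b.coord i).toContinuousLinearMap.contMDiff.contMDiffAt.comp x' h1
  · intro y hy w
    have h := (e.basisAt b hy).sum_repr w
    conv_lhs => rw [← h]
    refine Finset.sum_congr rfl fun i _ ↦ ?_
    rw [Trivialization.localFrame_apply_of_mem_baseSet _ _ hy]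
    rfl

end Along

/-! ### Connections along a map and the symmetries of their curvature. -/

section ConnectionAlong

variable {E : Type*} [NormedAddCommGroup E] [NormedSpace ℝ E]
  {H : Type*} [TopologicalSpace H] {I : ModelWithCorners ℝ E H}
  {M : Type*} [TopologicalSpace M] [ChartedSpace H M] [IsManifold I ∞ M]
  {E' : Type*} [NormedAddCommGroup E'] [NormedSpace ℝ E']
  {H' : Type*} [TopologicalSpace H'] {I' : ModelWithCorners ℝ E' H'}
  {N : Type*} [TopologicalSpace N] [ChartedSpace H' N]
  {F : Type*} [NormedAddCommGroup F] [NormedSpace ℝ F]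
  {W : N → Type*} [TopologicalSpace (TotalSpace F W)]
  [∀ y, AddCommGroup (W y)] [∀ y, Module ℝ (W y)] [∀ y, TopologicalSpace (W y)]
  [∀ y, IsTopologicalAddGroup (W y)] [FiberBundle F W]

variable (I I' F) in
/-- A smooth connection on the pullback of the vector bundle `W` by the map `f`. -/
structure IsBundleConnectionAlong (f : M → N)
    (nab : (Π x : M, W (f x)) → Π x : M, TangentSpace I x →L[ℝ] W (f x)) : Prop where
  add : ∀ (s t : Π x : M, W (f x)) (x : M),
    SmoothSectionAlongAt I I' F f s x → SmoothSectionAlongAt I I' F f t x →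
      nab (fun y ↦ s y + t y) x = nab s x + nab t x
  leibniz : ∀ (φ : M → ℝ) (s : Π x : M, W (f x)) (x : M),
    ContMDiffAt I 𝓘(ℝ, ℝ) ∞ φ x → SmoothSectionAlongAt I I' F f s x →
      ∀ u : TangentSpace I x,
        nab (fun y ↦ φ y • s y) x u = φ x • nab s x u + mvfderiv I φ x u • s x
  smooth : ∀ (s : Π x : M, W (f x)) (X : Π x : M, TangentSpace I x) (x : M),
    SmoothSectionAlongAt I I' F f s x → SmoothFieldAt X x →
      SmoothSectionAlongAt I I' F f (fun y ↦ nab s y (X y)) x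

/-- `∇_X ∇_Y s - ∇_Y ∇_X s - ∇_{[X,Y]} s` for a section `s` along a map. -/
noncomputable def curvatureAlong {f : M → N}
    (nab : (Π x : M, W (f x)) → Π x : M, TangentSpace I x →L[ℝ] W (f x))
    (X Y : Π x : M, TangentSpace I x) (s : Π x : M, W (f x)) (x : M) : W (f x) :=
  nab (fun y ↦ nab s y (Y y)) x (X x) - nab (fun y ↦ nab s y (X y)) x (Y x)
    - nab s x (VectorField.mlieBracket I X Y x)

namespace IsBundleConnectionAlong

variable {f : M → N} {nab : (Π x : M, W (f x)) → Π x : M, TangentSpace I x →L[ℝ] W (f x)}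
  {s t : Π x : M, W (f x)} {φ : M → ℝ} {x : M} {X Y : Π x : M, TangentSpace I x}

/-- Locality needs no bump function. The indicator `ψ` of the set where `t = s` is constant near
`x`, hence smooth at `x`, and `ψ t = ψ s` everywhere; the Leibniz rule on both sides gives the
claim. -/
theorem congr (hnab : IsBundleConnectionAlong I I' F f nab)
    (hs : SmoothSectionAlongAt I I' F f s x) (h : ∀ᶠ y in 𝓝 x, t y = s y) :
    nab t x = nab s x := by
  classical
  let ψ : M → ℝ := fun y ↦ if t y = s y then 1 else 0
  have hψ : ψ =ᶠ[𝓝 x] fun _ ↦ 1 := h.mono fun y hy ↦ by simp [ψ, hy]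
  have hψs : ContMDiffAt I 𝓘(ℝ, ℝ) ∞ ψ x := contMDiffAt_const.congr_of_eventuallyEq hψ
  have hψx : ψ x = 1 := hψ.self_of_nhds
  have hdψ : mvfderiv I ψ x = 0 := by
    rw [hψ.mvfderiv_eq, mvfderiv_const]
  have e : (fun y ↦ ψ y • t y) = fun y ↦ ψ y • s y := by
    funext y
    by_cases hy : t y = s y <;> simp [ψ, hy]
  ext u
  have h1 := hnab.leibniz ψ t x hψs (hs.congr h) u
  rw [e, hnab.leibniz ψ s x hψs hs u] at h1
  simpa [hψx, hdψ] using h1.symm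

theorem curvatureAlong_congr (hnab : IsBundleConnectionAlong I I' F f nab)
    (hX : SmoothFieldAt X x) (hY : SmoothFieldAt Y x)
    (hs : ∀ᶠ y in 𝓝 x, SmoothSectionAlongAt I I' F f s y) (h : ∀ᶠ y in 𝓝 x, t y = s y) :
    curvatureAlong nab X Y t x = curvatureAlong nab X Y s x := by
  have e : ∀ᶠ y in 𝓝 x, nab t y = nab s y := by
    filter_upwards [hs, eventually_eventually_nhds.2 h] with y hsy hy using hnab.congr hsy hy
  have key (Z : Π x : M, TangentSpace I x) (hZ : SmoothFieldAt Z x) :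
      nab (fun y ↦ nab t y (Z y)) x = nab (fun y ↦ nab s y (Z y)) x :=
    hnab.congr (hnab.smooth s Z x hs.self_of_nhds hZ) (e.mono fun y hy ↦ by rw [hy])
  simp only [curvatureAlong, key X hX, key Y hY, e.self_of_nhds]

theorem neg (hnab : IsBundleConnectionAlong I I' F f nab)
    (hs : SmoothSectionAlongAt I I' F f s x) : nab (fun y ↦ - s y) x = - nab s x := by
  ext u
  have h := hnab.leibniz (fun _ ↦ -1) s x contMDiffAt_const hs u
  simpa [mvfderiv_const] using h

variable [VectorBundle ℝ F W]

theorem zero (hnab : IsBundleConnectionAlong I I' F f nab) (hf : ContMDiffAt I I' ∞ f x) :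
    nab (fun y ↦ (0 : W (f y))) x = 0 := by
  have h := hnab.add _ _ x (SmoothSectionAlongAt.zero (F := F) (W := W) hf) (.zero hf)
  simpa using h

theorem sum_smul (hnab : IsBundleConnectionAlong I I' F f nab) (hf : ContMDiffAt I I' ∞ f x)
    {ι : Type*} (T : Finset ι) {c : ι → M → ℝ} {σ : ι → Π x : M, W (f x)}
    (hc : ∀ i, ContMDiffAt I 𝓘(ℝ, ℝ) ∞ (c i) x)
    (hσ : ∀ i, SmoothSectionAlongAt I I' F f (σ i) x) (u : TangentSpace I x) :
    nab (fun y ↦ ∑ i ∈ T, c i y • σ i y) x u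
      = ∑ i ∈ T, (c i x • nab (σ i) x u + mvfderiv I (c i) x u • σ i x) := by
  classical
  induction T using Finset.induction_on with
  | empty => simp [hnab.zero hf]
  | insert a T ha ih =>
    simp only [Finset.sum_insert ha]
    rw [hnab.add _ _ x ((hσ a).smul (hc a)) (.sum hf T fun i _ ↦ (hσ i).smul (hc i)),
      add_apply, ih, hnab.leibniz _ _ x (hc a) (hσ a)]

theorem curvatureAlong_add (hnab : IsBundleConnectionAlong I I' F f nab)
    (hX : ∀ᶠ y in 𝓝 x, SmoothFieldAt X y) (hY : ∀ᶠ y in 𝓝 x, SmoothFieldAt Y y)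
    (hs : ∀ᶠ y in 𝓝 x, SmoothSectionAlongAt I I' F f s y)
    (ht : ∀ᶠ y in 𝓝 x, SmoothSectionAlongAt I I' F f t y) :
    curvatureAlong nab X Y (fun y ↦ s y + t y) x
      = curvatureAlong nab X Y s x + curvatureAlong nab X Y t x := by
  have key (Z : Π x : M, TangentSpace I x) (hZ : SmoothFieldAt Z x) :
      nab (fun y ↦ nab (fun y ↦ s y + t y) y (Z y)) x
        = nab (fun y ↦ nab s y (Z y)) x + nab (fun y ↦ nab t y (Z y)) x := by
    have h1 := hnab.smooth s Z x hs.self_of_nhds hZ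
    have h2 := hnab.smooth t Z x ht.self_of_nhds hZ
    rw [← hnab.add _ _ x h1 h2]
    refine hnab.congr (h1.add h2) ?_
    filter_upwards [hs, ht] with y hsy hty
    rw [hnab.add _ _ y hsy hty, add_apply]
  simp only [curvatureAlong, key X hX.self_of_nhds, key Y hY.self_of_nhds,
    hnab.add _ _ x hs.self_of_nhds ht.self_of_nhds, add_apply]
  abel

/-- The cross terms such as `(X φ) ∇_Y s` are symmetric in `X` and `Y` and cancel; the second
derivatives of `φ` cancel against `[X, Y] φ`. -/
theorem curvatureAlong_smul [CompleteSpace E] (hnab : IsBundleConnectionAlong I I' F f nab)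
    (hX : SmoothFieldAt X x) (hY : SmoothFieldAt Y x)
    (hφ : ∀ᶠ y in 𝓝 x, ContMDiffAt I 𝓘(ℝ, ℝ) ∞ φ y)
    (hs : ∀ᶠ y in 𝓝 x, SmoothSectionAlongAt I I' F f s y) :
    curvatureAlong nab X Y (fun y ↦ φ y • s y) x = φ x • curvatureAlong nab X Y s x := by
  have hφx := hφ.self_of_nhds
  have hsx := hs.self_of_nhds
  have key (Z : Π x : M, TangentSpace I x) (hZ : SmoothFieldAt Z x) (u : TangentSpace I x) :
      nab (fun y ↦ nab (fun y ↦ φ y • s y) y (Z y)) x u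
        = (φ x • nab (fun y ↦ nab s y (Z y)) x u + mvfderiv I φ x u • nab s x (Z x))
          + (mvfderiv I φ x (Z x) • nab s x u
            + mvfderiv I (fun y ↦ mvfderiv I φ y (Z y)) x u • s x) := by
    have h1 := hnab.smooth s Z x hsx hZ
    have h2 := contMDiffAt_mvfderiv_apply hφx hZ
    rw [hnab.congr (s := fun y ↦ φ y • nab s y (Z y) + mvfderiv I φ y (Z y) • s y)
      ((h1.smul hφx).add (hsx.smul h2)), hnab.add _ _ x (h1.smul hφx) (hsx.smul h2),
      add_apply, hnab.leibniz _ _ x hφx h1, hnab.leibniz _ _ x h2 hsx]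
    filter_upwards [hφ, hs] with y h3 h4
    exact hnab.leibniz φ s y h3 h4 _
  rw [curvatureAlong, key Y hY, key X hX, hnab.leibniz _ _ x hφx hsx,
    mvfderiv_mlieBracket hφ hX hY, curvatureAlong]
  simp only [smul_sub, sub_smul]
  abel

theorem curvatureAlong_sum_smul [CompleteSpace E] (hnab : IsBundleConnectionAlong I I' F f nab)
    (hf : ∀ᶠ y in 𝓝 x, ContMDiffAt I I' ∞ f y)
    (hX : ∀ᶠ y in 𝓝 x, SmoothFieldAt X y) (hY : ∀ᶠ y in 𝓝 x, SmoothFieldAt Y y)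
    {ι : Type*} (T : Finset ι) {c : ι → M → ℝ} {σ : ι → Π x : M, W (f x)}
    (hc : ∀ i, ∀ᶠ y in 𝓝 x, ContMDiffAt I 𝓘(ℝ, ℝ) ∞ (c i) y)
    (hσ : ∀ i, ∀ᶠ y in 𝓝 x, SmoothSectionAlongAt I I' F f (σ i) y) :
    curvatureAlong nab X Y (fun y ↦ ∑ i ∈ T, c i y • σ i y) x
      = ∑ i ∈ T, c i x • curvatureAlong nab X Y (σ i) x := by
  classical
  have hcσ (i) : ∀ᶠ y in 𝓝 x, SmoothSectionAlongAt I I' F f (fun y ↦ c i y • σ i y) y := by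
    filter_upwards [hc i, hσ i] with y h1 h2 using h2.smul h1
  induction T using Finset.induction_on with
  | empty =>
    have h := hnab.curvatureAlong_smul hX.self_of_nhds hY.self_of_nhds (φ := fun _ ↦ 0)
      (s := fun y ↦ (0 : W (f y))) (x := x) (.of_forall fun _ ↦ contMDiffAt_const)
      (hf.mono fun y hy ↦ .zero hy)
    simpa using h
  | insert a T ha ih =>
    simp only [Finset.sum_insert ha]
    have hT : ∀ᶠ y in 𝓝 x, SmoothSectionAlongAt I I' F f (fun y ↦ ∑ i ∈ T, c i y • σ i y) y := by
      filter_upwards [hf, (Filter.eventually_all_finset T).2 fun i _ ↦ hcσ i] with y h1 h2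
      exact .sum h1 T h2
    rw [hnab.curvatureAlong_add hX hY (hcσ a) hT, ih,
      hnab.curvatureAlong_smul hX.self_of_nhds hY.self_of_nhds (hc a) (hσ a)]

/-- The curvature of a section along a map depends only on the value of the section. -/
theorem curvatureAlong_pointwise [CompleteSpace E] [FiniteDimensional ℝ F]
    [ContMDiffVectorBundle ∞ F W I'] (hnab : IsBundleConnectionAlong I I' F f nab)
    (hX : ∀ᶠ y in 𝓝 x, SmoothFieldAt X y) (hY : ∀ᶠ y in 𝓝 x, SmoothFieldAt Y y)
    (hs : ∀ᶠ y in 𝓝 x, SmoothSectionAlongAt I I' F f s y)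
    (ht : ∀ᶠ y in 𝓝 x, SmoothSectionAlongAt I I' F f t y) (hst : s x = t x) :
    curvatureAlong nab X Y s x = curvatureAlong nab X Y t x := by
  have hf : ∀ᶠ y in 𝓝 x, ContMDiffAt I I' ∞ f y := hs.mono fun y hy ↦ hy.base
  obtain ⟨n, Z, c, U, hU, hZ, hc, hcZ⟩ := exists_frame (I := I) (I' := I') (F := F) (W := W) f x
  have hfU : ∀ᶠ y in 𝓝 x, f y ∈ U := hf.self_of_nhds.continuousAt.eventually_mem hU
  have hZf (i) : ∀ᶠ y in 𝓝 x, SmoothSectionAlongAt I I' F f (fun y ↦ Z i (f y)) y := by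
    filter_upwards [hf, hfU] with y h1 h2 using smoothSectionAlongAt_comp h1 (hZ i _ h2)
  -- In a frame pulled back from the target, the curvature is linear over functions, and its
  -- coefficients at `x` see only `s x`.
  have key {s : Π x : M, W (f x)} (hs : ∀ᶠ y in 𝓝 x, SmoothSectionAlongAt I I' F f s y) :
      curvatureAlong nab X Y s x
        = ∑ i, c i (f x) (s x) • curvatureAlong nab X Y (fun y ↦ Z i (f y)) x := by
    have hcs (i) : ∀ᶠ y in 𝓝 x, ContMDiffAt I 𝓘(ℝ, ℝ) ∞ (fun y ↦ c i (f y) (s y)) y := by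
      filter_upwards [hs, hfU] with y h1 h2 using hc s y h2 h1 i
    rw [← hnab.curvatureAlong_sum_smul hf hX hY Finset.univ hcs hZf]
    refine hnab.curvatureAlong_congr hX.self_of_nhds hY.self_of_nhds ?_
      (hfU.mono fun y hy ↦ hcZ _ hy _)
    filter_upwards [hf, (Filter.eventually_all).2 hcs, (Filter.eventually_all).2 hZf]
      with y h1 h2 h3
    exact .sum h1 _ fun i _ ↦ (h3 i).smul (h2 i)
  rw [key hs, key ht, hst]

variable [∀ y, ContinuousSMul ℝ (W y)]

/-- The curvature of a metric connection is skew-adjoint. -/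
theorem bilin_curvatureAlong [CompleteSpace E] [ContMDiffVectorBundle ∞ F W I']
    (hnab : IsBundleConnectionAlong I I' F f nab) {g : Π y : N, W y →L[ℝ] W y →L[ℝ] ℝ}
    (hg : ContMDiff I' (I'.prod 𝓘(ℝ, F →L[ℝ] F →L[ℝ] ℝ)) ∞
      (fun y ↦ TotalSpace.mk' (F →L[ℝ] F →L[ℝ] ℝ) (E := fun y ↦ W y →L[ℝ] W y →L[ℝ] ℝ) y (g y)))
    (hmetric : ∀ (s t : Π x : M, W (f x)) (x : M), SmoothSectionAlongAt I I' F f s x →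
      SmoothSectionAlongAt I I' F f t x → ∀ u : TangentSpace I x,
        mvfderiv I (fun y ↦ g (f y) (s y) (t y)) x u
          = g (f x) (nab s x u) (t x) + g (f x) (s x) (nab t x u))
    (hX : SmoothFieldAt X x) (hY : SmoothFieldAt Y x)
    (hs : ∀ᶠ y in 𝓝 x, SmoothSectionAlongAt I I' F f s y)
    (ht : ∀ᶠ y in 𝓝 x, SmoothSectionAlongAt I I' F f t y) :
    g (f x) (curvatureAlong nab X Y s x) (t x)
      = - g (f x) (s x) (curvatureAlong nab X Y t x) := by
  have hsx := hs.self_of_nhds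
  have htx := ht.self_of_nhds
  have key (Z : Π x : M, TangentSpace I x) (hZ : SmoothFieldAt Z x) (u : TangentSpace I x) :
      mvfderiv I (fun y ↦ mvfderiv I (fun y ↦ g (f y) (s y) (t y)) y (Z y)) x u
        = (g (f x) (nab (fun y ↦ nab s y (Z y)) x u) (t x) + g (f x) (nab s x (Z x)) (nab t x u))
        + (g (f x) (nab s x u) (nab t x (Z x))
          + g (f x) (s x) (nab (fun y ↦ nab t y (Z y)) x u)) := by
    have h1 := hnab.smooth s Z x hsx hZ
    have h2 := hnab.smooth t Z x htx hZ
    have e : (fun y ↦ mvfderiv I (fun y ↦ g (f y) (s y) (t y)) y (Z y)) =ᶠ[𝓝 x]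
        fun y ↦ g (f y) (nab s y (Z y)) (t y) + g (f y) (s y) (nab t y (Z y)) := by
      filter_upwards [hs, ht] with y h3 h4 using hmetric s t y h3 h4 _
    rw [← hmetric _ _ x h1 htx, ← hmetric _ _ x hsx h2, ← add_apply,
      ← mvfderiv_fun_add ((h1.bilin hg htx).mdifferentiableAt (by simp))
      ((hsx.bilin hg h2).mdifferentiableAt (by simp))]
    rw [e.mvfderiv_eq]
  -- In the commutator of the second derivatives of `g(s, t)`, the products of first derivatives are
  -- symmetric in `X` and `Y` and drop out.
  have h := mvfderiv_mlieBracket (φ := fun y ↦ g (f y) (s y) (t y)) (x := x)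
    (by filter_upwards [hs, ht] with y h1 h2 using h1.bilin hg h2) hX hY
  rw [key Y hY, key X hX, hmetric _ _ x hsx htx] at h
  simp only [curvatureAlong, map_sub, sub_apply]
  linarith

/-- The curvature of a connection commutes with a parallel endomorphism. -/
theorem curvatureAlong_endo [ContMDiffVectorBundle ∞ F W I']
    (hnab : IsBundleConnectionAlong I I' F f nab) {J : Π y : N, W y →L[ℝ] W y}
    (hJ : ContMDiff I' (I'.prod 𝓘(ℝ, F →L[ℝ] F)) ∞
      (fun y ↦ TotalSpace.mk' (F →L[ℝ] F) (E := fun y ↦ W y →L[ℝ] W y) y (J y)))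
    (hparallel : ∀ (s : Π x : M, W (f x)) (x : M), SmoothSectionAlongAt I I' F f s x →
      ∀ u : TangentSpace I x, nab (fun y ↦ J (f y) (s y)) x u = J (f x) (nab s x u))
    (hX : SmoothFieldAt X x) (hY : SmoothFieldAt Y x)
    (hs : ∀ᶠ y in 𝓝 x, SmoothSectionAlongAt I I' F f s y) :
    curvatureAlong nab X Y (fun y ↦ J (f y) (s y)) x
      = J (f x) (curvatureAlong nab X Y s x) := by
  have hsx := hs.self_of_nhds
  have key (Z : Π x : M, TangentSpace I x) (hZ : SmoothFieldAt Z x) (u : TangentSpace I x) :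
      nab (fun y ↦ nab (fun y ↦ J (f y) (s y)) y (Z y)) x u
        = J (f x) (nab (fun y ↦ nab s y (Z y)) x u) := by
    have h1 := hnab.smooth s Z x hsx hZ
    rw [← hparallel _ x h1, hnab.congr (h1.endo hJ)]
    filter_upwards [hs] with y hy using hparallel s y hy _
  simp only [curvatureAlong, key X hX, key Y hY, hparallel s x hsx, map_sub]

end IsBundleConnectionAlong

end ConnectionAlong

/-! ### Reduction to sections that come from the target. -/

section Induction

variable {E : Type*} [NormedAddCommGroup E] [NormedSpace ℝ E]
  {H : Type*} [TopologicalSpace H] {I : ModelWithCorners ℝ E H}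
  {M : Type*} [TopologicalSpace M] [ChartedSpace H M]
  {E' : Type*} [NormedAddCommGroup E'] [NormedSpace ℝ E']
  {H' : Type*} [TopologicalSpace H'] {I' : ModelWithCorners ℝ E' H'}
  {N : Type*} [TopologicalSpace N] [ChartedSpace H' N]
  {F : Type*} [NormedAddCommGroup F] [NormedSpace ℝ F]
  {W : N → Type*} [TopologicalSpace (TotalSpace F W)]
  [∀ y, TopologicalSpace (W y)] [FiberBundle F W]
  [∀ y, AddCommGroup (W y)] [∀ y, Module ℝ (W y)] [VectorBundle ℝ F W]
  [ContMDiffVectorBundle ∞ F W I'] [FiniteDimensional ℝ F]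

/-- A property of germs of sections along `f` that is stable under linear combinations with smooth
coefficients holds for all smooth sections if it does for those that come from the target. -/
theorem SmoothSectionAlongAt.induction {f : M → N} {x : M} {P : (Π x : M, W (f x)) → Prop}
    (hadd : ∀ s t, SmoothSectionAlongAt I I' F f s x → SmoothSectionAlongAt I I' F f t x →
      P s → P t → P (fun y ↦ s y + t y))
    (hsmul : ∀ (φ : M → ℝ) s, ContMDiffAt I 𝓘(ℝ, ℝ) ∞ φ x → SmoothSectionAlongAt I I' F f s x →
      P s → P (fun y ↦ φ y • s y))
    (hcongr : ∀ s t, SmoothSectionAlongAt I I' F f s x → (∀ᶠ y in 𝓝 x, t y = s y) → P s → P t)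
    (hcomp : ∀ Z : Π y : N, W y,
      ContMDiffAt I' (I'.prod 𝓘(ℝ, F)) ∞ (fun y ↦ (⟨y, Z y⟩ : TotalSpace F W)) (f x) →
        P (fun y ↦ Z (f y)))
    {s : Π x : M, W (f x)} (hs : SmoothSectionAlongAt I I' F f s x) : P s := by
  classical
  obtain ⟨n, Z, c, U, hU, hZ, hc, hcZ⟩ :=
    exists_frame (I := I) (I' := I') (F := F) (W := W) f x
  have hf := hs.base
  have hZx (i) := hZ i (f x) (mem_of_mem_nhds hU)
  have hcx := hc s x (mem_of_mem_nhds hU) hs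
  have hterm (i) := (smoothSectionAlongAt_comp hf (hZx i)).smul (hcx i)
  have key (T : Finset (Fin n)) : P (fun y ↦ ∑ i ∈ T, c i (f y) (s y) • Z i (f y)) := by
    induction T using Finset.induction_on with
    | empty =>
      simpa using hcomp (fun y ↦ 0) (contMDiff_zeroSection ℝ W).contMDiffAt
    | insert a T ha ih =>
      simp only [Finset.sum_insert ha]
      exact hadd _ _ (hterm a) (.sum hf T fun i _ ↦ hterm i)
        (hsmul _ _ (hcx a) (smoothSectionAlongAt_comp hf (hZx a)) (hcomp _ (hZx a))) ih
  refine hcongr _ s (.sum hf Finset.univ fun i _ ↦ hterm i) ?_ (key Finset.univ)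
  exact (hf.continuousAt.eventually_mem hU).mono fun y hy ↦ hcZ _ hy _

end Induction

/-! ### Coordinate vector fields. -/

section Coordinates

variable {E : Type*} [NormedAddCommGroup E] [NormedSpace ℝ E] [FiniteDimensional ℝ E]
  {H : Type*} [TopologicalSpace H] {I : ModelWithCorners ℝ E H}
  {M : Type*} [TopologicalSpace M] [ChartedSpace H M] [IsManifold I ∞ M]

variable (I) in
/-- Local coordinates `φ` with their commuting coordinate vector fields `Z`. -/
theorem exists_coordinates (x : M) :
    ∃ (n : ℕ) (Z : Fin n → Π y : M, TangentSpace I y) (φ : Fin n → M → ℝ) (U : Set M),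
      U ∈ 𝓝 x ∧ (∀ i, ∀ y ∈ U, SmoothFieldAt (Z i) y) ∧
      (∀ i, ∀ y ∈ U, ContMDiffAt I 𝓘(ℝ, ℝ) ∞ (φ i) y) ∧
      (∀ y ∈ U, ∀ w : TangentSpace I y, w = ∑ i, mvfderiv I (φ i) y w • Z i y) ∧
      ∀ i j, VectorField.mlieBracket I (Z i) (Z j) x = 0 := by
  classical
  have : IsManifold I 1 M := IsManifold.of_le (n := ∞) (by simp)
  have : CompleteSpace E := FiniteDimensional.complete ℝ E
  let b := Module.finBasis ℝ E
  let e := trivializationAt E (TangentSpace I) x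
  let L (i) : E →L[ℝ] ℝ := (b.coord i).toContinuousLinearMap
  have hbase : e.baseSet = (chartAt H x).source := TangentBundle.trivializationAt_baseSet x
  have hxU : e.baseSet ∈ 𝓝 x :=
    e.open_baseSet.mem_nhds (FiberBundle.mem_baseSet_trivializationAt' _)
  have hZ (i) (y) (hy : y ∈ e.baseSet) : SmoothFieldAt (I := I) (e.localFrame b i) y :=
    contMDiffAt_localFrame_of_mem _ e b i hy
  have hφ (i) (y) (hy : y ∈ e.baseSet) :
      ContMDiffAt I 𝓘(ℝ, ℝ) ∞ (fun y ↦ L i (extChartAt I x y)) y :=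
    (L i).contMDiff.contMDiffAt.comp y (contMDiffAt_extChartAt' (by rwa [← hbase]))
  -- The trivialization of the tangent bundle is the derivative of the chart, so the differentials
  -- of the coordinates are the coefficients in the frame.
  have hdφ (i) (y) (hy : y ∈ e.baseSet) (w : TangentSpace I y) :
      mvfderiv I (fun y ↦ L i (extChartAt I x y)) y w = b.repr (e ⟨y, w⟩).2 i := by
    have h1 : MDifferentiableAt I 𝓘(ℝ, E) (extChartAt I x) y :=
      mdifferentiableAt_extChartAt (by rwa [← hbase])
    have h2 := mvfderiv_comp_apply (I := 𝓘(ℝ, E)) (g := L i) (f := extChartAt I x) y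
      (L i).mdifferentiableAt h1 w
    have h3 : (e ⟨y, w⟩).2 = mfderiv I 𝓘(ℝ, E) (extChartAt I x) y w := by
      have h4 : (e ⟨y, w⟩).2 = e.continuousLinearMapAt ℝ y w := by
        rw [Trivialization.continuousLinearMapAt_apply, Trivialization.linearMapAt_apply, if_pos hy]
      exact h4.trans (DFunLike.congr_fun
        (TangentBundle.continuousLinearMapAt_trivializationAt (I := I) (by rwa [← hbase])) w)
    rw [h3]
    refine Eq.trans h2 ?_
    rw [mvfderiv, ContinuousLinearMap.mfderiv_eq]
    rfl
  have hdφZ (i j) (y) (hy : y ∈ e.baseSet) :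
      mvfderiv I (fun y ↦ L i (extChartAt I x y)) y (e.localFrame b j y)
        = if j = i then 1 else 0 := by
    rw [hdφ i y hy, Trivialization.localFrame_apply_of_mem_baseSet _ _ hy]
    simp [Trivialization.basisAt, hy, Finsupp.single_apply]
  have hspan (y) (hy : y ∈ e.baseSet) (w : TangentSpace I y) :
      w = ∑ i, mvfderiv I (fun y ↦ L i (extChartAt I x y)) y w • e.localFrame b i y := by
    have h := (e.basisAt b hy).sum_repr w
    conv_lhs => rw [← h]
    refine Finset.sum_congr rfl fun i _ ↦ ?_
    rw [Trivialization.localFrame_apply_of_mem_baseSet _ _ hy, hdφ i y hy]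
    rfl
  refine ⟨_, e.localFrame b, fun i y ↦ L i (extChartAt I x y), e.baseSet, hxU, hZ, hφ, hspan, ?_⟩
  intro i j
  have hx := mem_of_mem_nhds hxU
  -- The functions `Z_j φ_k` are locally constant, so the bracket of two frame fields kills every
  -- coordinate, and these derivatives are its coefficients in the frame.
  have hconst (i j k) : mvfderiv I (fun y ↦ mvfderiv I (fun y ↦ L k (extChartAt I x y)) y
      (e.localFrame b j y)) x (e.localFrame b i x) = 0 := by
    have h : (fun y ↦ mvfderiv I (fun y ↦ L k (extChartAt I x y)) y
        (e.localFrame b j y)) =ᶠ[𝓝 x] fun _ ↦ if j = k then 1 else 0 := by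
      filter_upwards [hxU] with y hy using hdφZ k j y hy
    rw [h.mvfderiv_eq, mvfderiv_const]
    rfl
  rw [hspan x hx (VectorField.mlieBracket I _ _ x)]
  refine Finset.sum_eq_zero fun k _ ↦ ?_
  rw [mvfderiv_mlieBracket (by filter_upwards [hxU] with y hy using hφ k y hy) (hZ i x hx)
    (hZ j x hx), hconst i j k, hconst j i k, sub_zero, zero_smul]

end Coordinates

/-! ### The pullback of the Levi-Civita connection is a Kaehler connection. -/

section Pullback

variable {M : Type*} [TopologicalSpace M] [ChartedSpace (R 2) M] [IsManifold (𝓡 2) ∞ M]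
  {N : Type*} [TopologicalSpace N] [ChartedSpace (R 4) N] [IsManifold (𝓡 4) ∞ N]
  {gN : Π y : N, TangentSpace (𝓡 4) y →L[ℝ] TangentSpace (𝓡 4) y →L[ℝ] ℝ}
  {J : Π y : N, TangentSpace (𝓡 4) y →L[ℝ] TangentSpace (𝓡 4) y}
  {nablaN : CovariantDerivative (𝓡 4) (R 4) (TangentSpace (𝓡 4) : N → Type _)} {f : M → N}
  {nab : (Π x : M, TangentSpace (𝓡 4) (f x)) →
    Π x : M, TangentSpace (𝓡 2) x →L[ℝ] TangentSpace (𝓡 4) (f x)}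

theorem IsConnectionAlong.isBundleConnectionAlong (h : IsConnectionAlong f nab) :
    IsBundleConnectionAlong (𝓡 2) (𝓡 4) (R 4) f nab where
  add := h.add
  leibniz := h.leibniz
  smooth := h.smooth

/-- The pullback connection is prescribed only on fields that come from `N`. Both sides obey the
same sum and Leibniz rules in `s` and in `t`, so an induction in each reduces the claim to such
fields, where it is the chain rule. -/
theorem IsPullbackConnection.metric (h : IsPullbackConnection nablaN f nab)
    (hf : ContMDiff (𝓡 2) (𝓡 4) ∞ f) (hg : IsSemiRiemannianMetric gN)
    (hLC : IsLeviCivita gN nablaN) {s t : Π x : M, TangentSpace (𝓡 4) (f x)} {x : M}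
    (hs : SmoothAlongAt f s x) (ht : SmoothAlongAt f t x) (u : TangentSpace (𝓡 2) x) :
    mvfderiv (𝓡 2) (fun y ↦ gN (f y) (s y) (t y)) x u
      = gN (f x) (nab s x u) (t x) + gN (f x) (s x) (nab t x u) := by
  have hnab := h.toIsConnectionAlong.isBundleConnectionAlong
  have md {s t : Π x : M, TangentSpace (𝓡 4) (f x)}
      (hs : SmoothSectionAlongAt (𝓡 2) (𝓡 4) (R 4) f s x)
      (ht : SmoothSectionAlongAt (𝓡 2) (𝓡 4) (R 4) f t x) :
      MDifferentiableAt (𝓡 2) 𝓘(ℝ, ℝ) (fun y ↦ gN (f y) (s y) (t y)) x :=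
    (hs.bilin hg.smooth ht).mdifferentiableAt (by simp)
  revert t
  refine SmoothSectionAlongAt.induction (I := 𝓡 2) (I' := 𝓡 4) (F := R 4)
    (P := fun s ↦ ∀ {t : Π x : M, TangentSpace (𝓡 4) (f x)}, SmoothAlongAt f t x →
      mvfderiv (𝓡 2) (fun y ↦ gN (f y) (s y) (t y)) x u
        = gN (f x) (nab s x u) (t x) + gN (f x) (s x) (nab t x u)) ?_ ?_ ?_ ?_ hs
  · intro s s' hs hs' h1 h2 t ht
    simp only [map_add, add_apply]
    rw [mvfderiv_fun_add (md hs ht) (md hs' ht), hnab.add _ _ x hs hs']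
    simp only [map_add, add_apply]
    rw [h1 ht, h2 ht]
    ring
  · intro φ s hφ hs h1 t ht
    simp only [map_smul, smul_apply, smul_eq_mul]
    rw [mvfderiv_fun_mul (hφ.mdifferentiableAt (by simp)) (md hs ht), hnab.leibniz _ _ x hφ hs]
    simp only [map_add, map_smul, add_apply, smul_apply, smul_eq_mul, h1 ht]
    ring
  · intro s s' hs hss h1 t ht
    have e : (fun y ↦ gN (f y) (s' y) (t y)) =ᶠ[𝓝 x] fun y ↦ gN (f y) (s y) (t y) :=
      hss.mono fun y hy ↦ by simp only [hy]
    rw [e.mvfderiv_eq, h1 ht, hnab.congr hs hss, hss.self_of_nhds]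
  intro Z hZ t ht
  have hZs := smoothSectionAlongAt_comp (hf x) hZ
  refine SmoothSectionAlongAt.induction (I := 𝓡 2) (I' := 𝓡 4) (F := R 4)
    (P := fun t ↦ mvfderiv (𝓡 2) (fun y ↦ gN (f y) (Z (f y)) (t y)) x u
        = gN (f x) (nab (fun y ↦ Z (f y)) x u) (t x)
          + gN (f x) (Z (f x)) (nab t x u)) ?_ ?_ ?_ ?_ ht
  · intro t t' ht ht' h1 h2
    simp only [map_add]
    rw [mvfderiv_fun_add (md hZs ht) (md hZs ht'), hnab.add _ _ x ht ht']
    simp only [map_add, add_apply]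
    rw [h1, h2]
    ring
  · intro φ t hφ ht h1
    simp only [map_smul, smul_eq_mul]
    rw [mvfderiv_fun_mul (hφ.mdifferentiableAt (by simp)) (md hZs ht), hnab.leibniz _ _ x hφ ht]
    simp only [map_add, map_smul, add_apply, smul_apply, smul_eq_mul, h1]
    ring
  · intro t t' ht htt h1
    have e : (fun y ↦ gN (f y) (Z (f y)) (t' y)) =ᶠ[𝓝 x] fun y ↦ gN (f y) (Z (f y)) (t y) :=
      htt.mono fun y hy ↦ by simp only [hy]
    rw [e.mvfderiv_eq, h1, hnab.congr ht htt, htt.self_of_nhds]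
  intro Z' hZ'
  have hG : MDifferentiableAt (𝓡 4) 𝓘(ℝ, ℝ) (fun y ↦ gN y (Z y) (Z' y)) (f x) :=
    (SmoothSectionAlongAt.bilin (I := 𝓡 4) (I' := 𝓡 4) (f := fun y : N ↦ y) hg.smooth
      hZ hZ').mdifferentiableAt (by simp)
  have hfx : MDifferentiableAt (𝓡 2) (𝓡 4) f x := (hf x).mdifferentiableAt (by simp)
  refine (mvfderiv_comp_apply x hG hfx u).trans ?_
  rw [hLC.metric Z Z' (f x) hZ hZ', h.comp Z x hZ, h.comp Z' x hZ']

theorem IsPullbackConnection.parallel (h : IsPullbackConnection nablaN f nab)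
    (hN : IsLorentzianKaehler gN J nablaN) {s : Π x : M, TangentSpace (𝓡 4) (f x)} {x : M}
    (hs : SmoothAlongAt f s x) (u : TangentSpace (𝓡 2) x) :
    nab (fun y ↦ J (f y) (s y)) x u = J (f x) (nab s x u) := by
  have hnab := h.toIsConnectionAlong.isBundleConnectionAlong
  refine SmoothSectionAlongAt.induction (I := 𝓡 2) (I' := 𝓡 4) (F := R 4)
    (P := fun s ↦ nab (fun y ↦ J (f y) (s y)) x u = J (f x) (nab s x u)) ?_ ?_ ?_ ?_ hs
  · intro s t hs ht h1 h2
    simp only [map_add]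
    rw [hnab.add _ _ x (hs.endo hN.smooth) (ht.endo hN.smooth), hnab.add _ _ x hs ht]
    simp only [map_add, add_apply, h1, h2]
  · intro φ s hφ hs h1
    simp only [map_smul]
    rw [hnab.leibniz _ _ x hφ (hs.endo hN.smooth), hnab.leibniz _ _ x hφ hs]
    simp only [map_add, map_smul, h1]
  · intro s t hs hst h1
    rw [hnab.congr hs hst, ← h1, hnab.congr (hs.endo hN.smooth)]
    exact hst.mono fun y hy ↦ by simp only [hy]
  · intro Z hZ
    have hJZ : SmoothFieldAt (fun y ↦ J y (Z y)) (f x) :=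
      SmoothSectionAlongAt.endo (I := 𝓡 4) (I' := 𝓡 4) (f := fun y : N ↦ y) hN.smooth hZ
    rw [h.comp Z x hZ, ← hN.parallel Z (f x) hZ, ← h.comp _ x hJZ]

/-- With coordinate fields `Z_i` on `N` and `ψ_i` the coordinates of `f`, one has `df(Y) = ∑ (Y ψ_i)
Z_i`. Then `∇_X df(Y)` is a sum of `(Y ψ_i)(X ψ_j) ∇_{Z_j} Z_i`, symmetric in `X` and `Y` because
the `Z_i` commute and `N` has no torsion, and of `X(Y ψ_i) Z_i`, whose skew part is `df [X, Y]`. -/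
theorem IsPullbackConnection.torsion_free (h : IsPullbackConnection nablaN f nab)
    (hf : ContMDiff (𝓡 2) (𝓡 4) ∞ f) (hLC : IsLeviCivita gN nablaN)
    {X Y : Π x : M, TangentSpace (𝓡 2) x} {x : M} (hX : SmoothFieldAt X x)
    (hY : SmoothFieldAt Y x) :
    nab (fun y ↦ mfderiv (𝓡 2) (𝓡 4) f y (Y y)) x (X x)
        - nab (fun y ↦ mfderiv (𝓡 2) (𝓡 4) f y (X y)) x (Y x)
      = mfderiv (𝓡 2) (𝓡 4) f x (VectorField.mlieBracket (𝓡 2) X Y x) := by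
  have hnab := h.toIsConnectionAlong.isBundleConnectionAlong
  obtain ⟨n, Z, φ, U, hU, hZ, hφ, hspan, hcomm⟩ := exists_coordinates (𝓡 4) (f x)
  have hfx : f x ∈ U := mem_of_mem_nhds hU
  have hZx (i) : SmoothSectionAlongAt (𝓡 2) (𝓡 4) (R 4) f (fun y ↦ Z i (f y)) x :=
    smoothSectionAlongAt_comp (hf x) (hZ i _ hfx)
  have hfU : ∀ᶠ y in 𝓝 x, f y ∈ U := (hf x).continuousAt.eventually_mem hU
  let ψ (i) (y : M) : ℝ := φ i (f y)
  have hψ (i) : ∀ᶠ y in 𝓝 x, ContMDiffAt (𝓡 2) 𝓘(ℝ, ℝ) ∞ (ψ i) y := by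
    filter_upwards [hfU] with y hy using (hφ i _ hy).comp y (hf y)
  have hdf (y : M) (hy : f y ∈ U) (u : TangentSpace (𝓡 2) y) :
      mfderiv (𝓡 2) (𝓡 4) f y u = ∑ i, mvfderiv (𝓡 2) (ψ i) y u • Z i (f y) := by
    refine (hspan _ hy (mfderiv (𝓡 2) (𝓡 4) f y u)).trans (Finset.sum_congr rfl fun i _ ↦ ?_)
    have h1 := mvfderiv_comp_apply (I := 𝓡 4) (g := φ i) (f := f) y
      ((hφ i _ hy).mdifferentiableAt (by simp)) ((hf y).mdifferentiableAt (by simp)) u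
    rw [← h1]
    rfl
  have expand {X Y : Π x : M, TangentSpace (𝓡 2) x} (hX : SmoothFieldAt X x)
      (hY : SmoothFieldAt Y x) :
      nab (fun y ↦ mfderiv (𝓡 2) (𝓡 4) f y (Y y)) x (X x)
        = ∑ i, ∑ j, (mvfderiv (𝓡 2) (ψ i) x (Y x) * mvfderiv (𝓡 2) (ψ j) x (X x))
              • nablaN (Z i) (f x) (Z j (f x))
          + ∑ i, mvfderiv (𝓡 2) (fun y ↦ mvfderiv (𝓡 2) (ψ i) y (Y y)) x (X x) • Z i (f x) := by
    have hc (i) : ContMDiffAt (𝓡 2) 𝓘(ℝ, ℝ) ∞ (fun y ↦ mvfderiv (𝓡 2) (ψ i) y (Y y)) x :=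
      contMDiffAt_mvfderiv_apply (hψ i).self_of_nhds hY
    rw [hnab.congr (.sum (hf x) Finset.univ fun i _ ↦ (hZx i).smul (hc i))
        (hfU.mono fun y hy ↦ hdf y hy (Y y)),
      hnab.sum_smul (hf x) Finset.univ hc hZx, Finset.sum_add_distrib]
    congr 1
    refine Finset.sum_congr rfl fun i _ ↦ ?_
    rw [h.comp (Z i) x (hZ i _ hfx), hdf x hfx (X x), map_sum, Finset.smul_sum]
    refine Finset.sum_congr rfl fun j _ ↦ ?_
    rw [map_smul, smul_smul]
  have hsymm (i j) : nablaN (Z i) (f x) (Z j (f x)) = nablaN (Z j) (f x) (Z i (f x)) := by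
    rw [← sub_eq_zero, hLC.torsion_free (Z j) (Z i) (f x) (hZ j _ hfx) (hZ i _ hfx), hcomm]
  rw [expand hX hY, expand hY hX, hdf x hfx]
  have e : ∑ i, ∑ j, (mvfderiv (𝓡 2) (ψ i) x (X x) * mvfderiv (𝓡 2) (ψ j) x (Y x))
        • nablaN (Z i) (f x) (Z j (f x))
      = ∑ i, ∑ j, (mvfderiv (𝓡 2) (ψ i) x (Y x) * mvfderiv (𝓡 2) (ψ j) x (X x))
        • nablaN (Z i) (f x) (Z j (f x)) := by
    rw [Finset.sum_comm]
    refine Finset.sum_congr rfl fun i _ ↦ Finset.sum_congr rfl fun j _ ↦ ?_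
    rw [hsymm, mul_comm]
  rw [e, add_sub_add_left_eq_sub, ← Finset.sum_sub_distrib]
  refine Finset.sum_congr rfl fun i _ ↦ ?_
  rw [mvfderiv_mlieBracket (hψ i) hX hY, sub_smul]

/-- The pullback of the Levi-Civita connection of a Kaehler manifold is a Kaehler connection. -/
theorem IsPullbackConnection.isKaehlerConnectionAlong (h : IsPullbackConnection nablaN f nab)
    (hf : ContMDiff (𝓡 2) (𝓡 4) ∞ f) (hN : IsLorentzianKaehler gN J nablaN) :
    IsKaehlerConnectionAlong gN J f (fun x ↦ mfderiv (𝓡 2) (𝓡 4) f x) nab where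
  toIsConnectionAlong := h.toIsConnectionAlong
  metric _ _ _ hs ht u := h.metric hf hN.metric hN.levi_civita hs ht u
  parallel _ _ hs u := h.parallel hN hs u
  torsion_free _ _ _ hX hY := h.torsion_free hf hN.levi_civita hX hY

end Pullback

/-! ### Curvature on vectors, through extensions on the target. -/

section ExtendAlong

variable {E : Type*} [NormedAddCommGroup E] [NormedSpace ℝ E]
  {H : Type*} [TopologicalSpace H] {I : ModelWithCorners ℝ E H}
  {M : Type*} [TopologicalSpace M] [ChartedSpace H M]
  {E' : Type*} [NormedAddCommGroup E'] [NormedSpace ℝ E']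
  {H' : Type*} [TopologicalSpace H'] {I' : ModelWithCorners ℝ E' H'}
  {N : Type*} [TopologicalSpace N] [ChartedSpace H' N]
  {F : Type*} [NormedAddCommGroup F] [NormedSpace ℝ F]
  {W : N → Type*} [TopologicalSpace (TotalSpace F W)]
  [∀ y, AddCommGroup (W y)] [∀ y, Module ℝ (W y)] [∀ y, TopologicalSpace (W y)]
  [FiberBundle F W] [VectorBundle ℝ F W] [ContMDiffVectorBundle ∞ F W I']

theorem eventually_contMDiffAt_extend {y : N} (w : W y) :
    ∀ᶠ z in 𝓝 y, ContMDiffAt I' (I'.prod 𝓘(ℝ, F)) ∞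
      (fun z ↦ (⟨z, FiberBundle.extend F w z⟩ : TotalSpace F W)) z := by
  obtain ⟨s, hs, h⟩ := FiberBundle.exists_contMDiffOn_extend (k := ∞) I' F w
  filter_upwards [eventually_mem_nhds_iff.2 hs] with z hz using h.contMDiffAt hz

theorem eventually_smoothSectionAlongAt_extend {f : M → N} (hf : ContMDiff I I' ∞ f) {x : M}
    (w : W (f x)) :
    ∀ᶠ y in 𝓝 x, SmoothSectionAlongAt I I' F f (fun y ↦ FiberBundle.extend F w (f y)) y := by
  filter_upwards [(hf x).continuousAt.eventually
    (eventually_contMDiffAt_extend (F := F) (I' := I') w)]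
    with y hy using smoothSectionAlongAt_comp (hf y) hy

variable [CompleteSpace E] [IsManifold I ∞ M]
  [∀ y, IsTopologicalAddGroup (W y)] [∀ y, ContinuousSMul ℝ (W y)]
  {f : M → N} {nab : (Π x : M, W (f x)) → Π x : M, TangentSpace I x →L[ℝ] W (f x)}
  {x : M} {X Y : Π x : M, TangentSpace I x}

theorem IsBundleConnectionAlong.bilin_curvatureAlong_extend
    (hnab : IsBundleConnectionAlong I I' F f nab) (hf : ContMDiff I I' ∞ f)
    {g : Π y : N, W y →L[ℝ] W y →L[ℝ] ℝ}
    (hg : ContMDiff I' (I'.prod 𝓘(ℝ, F →L[ℝ] F →L[ℝ] ℝ)) ∞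
      (fun y ↦ TotalSpace.mk' (F →L[ℝ] F →L[ℝ] ℝ) (E := fun y ↦ W y →L[ℝ] W y →L[ℝ] ℝ) y (g y)))
    (hmetric : ∀ (s t : Π x : M, W (f x)) (x : M), SmoothSectionAlongAt I I' F f s x →
      SmoothSectionAlongAt I I' F f t x → ∀ u : TangentSpace I x,
        mvfderiv I (fun y ↦ g (f y) (s y) (t y)) x u
          = g (f x) (nab s x u) (t x) + g (f x) (s x) (nab t x u))
    (hX : SmoothFieldAt X x) (hY : SmoothFieldAt Y x) (w w' : W (f x)) :
    g (f x) (curvatureAlong nab X Y (fun y ↦ FiberBundle.extend F w (f y)) x) w'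
      = - g (f x) w (curvatureAlong nab X Y (fun y ↦ FiberBundle.extend F w' (f y)) x) := by
  simpa using hnab.bilin_curvatureAlong hg hmetric hX hY
    (eventually_smoothSectionAlongAt_extend hf w) (eventually_smoothSectionAlongAt_extend hf w')

/-- The extension of `J w` and the image under `J` of the extension of `w` are only known to agree
at the base point, so tensoriality is needed. -/
theorem IsBundleConnectionAlong.curvatureAlong_extend_endo [FiniteDimensional ℝ F]
    (hnab : IsBundleConnectionAlong I I' F f nab) (hf : ContMDiff I I' ∞ f)
    {J : Π y : N, W y →L[ℝ] W y}
    (hJ : ContMDiff I' (I'.prod 𝓘(ℝ, F →L[ℝ] F)) ∞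
      (fun y ↦ TotalSpace.mk' (F →L[ℝ] F) (E := fun y ↦ W y →L[ℝ] W y) y (J y)))
    (hparallel : ∀ (s : Π x : M, W (f x)) (x : M), SmoothSectionAlongAt I I' F f s x →
      ∀ u : TangentSpace I x, nab (fun y ↦ J (f y) (s y)) x u = J (f x) (nab s x u))
    (hX : ∀ᶠ y in 𝓝 x, SmoothFieldAt X y) (hY : ∀ᶠ y in 𝓝 x, SmoothFieldAt Y y) (w : W (f x)) :
    curvatureAlong nab X Y (fun y ↦ FiberBundle.extend F (J (f x) w) (f y)) x
      = J (f x) (curvatureAlong nab X Y (fun y ↦ FiberBundle.extend F w (f y)) x) := by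
  have hw := eventually_smoothSectionAlongAt_extend (F := F) hf w
  rw [← hnab.curvatureAlong_endo hJ hparallel hX.self_of_nhds hY.self_of_nhds hw]
  refine hnab.curvatureAlong_pointwise hX hY (eventually_smoothSectionAlongAt_extend hf _)
    (hw.mono fun y hy ↦ hy.endo hJ) ?_
  simp

end ExtendAlong

/-! ### Linear algebra at a point. -/

section PointwiseAlgebra

variable {T V W : Type*} [AddCommGroup T] [Module ℝ T] [AddCommGroup V] [Module ℝ V]
  [AddCommGroup W] [Module ℝ W]

/-- Two vectors on which a symmetric form is negative, and which are orthogonal, span a plane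
on which the form is negative definite. -/
theorem negative_definite_span_pair {g : T → T → ℝ} (hadd : ∀ u v w, g (u + v) w = g u w + g v w)
    (hsmul : ∀ (a : ℝ) u v, g (a • u) v = a * g u v) (hsymm : ∀ u v, g u v = g v u) {u v : T}
    (hu : g u u < 0) (hv : g v v < 0) (huv : g u v = 0) :
    Module.finrank ℝ (Submodule.span ℝ {u, v}) = 2 ∧
      ∀ w ∈ Submodule.span ℝ {u, v}, w ≠ 0 → g w w < 0 := by
  have hcomb (a b : ℝ) : g (a • u + b • v) (a • u + b • v) = a ^ 2 * g u u + b ^ 2 * g v v := by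
    rw [hadd, hsmul, hsmul, hsymm u, hsymm v, hadd, hadd, hsmul, hsmul, hsmul, hsmul, huv,
      hsymm v u, huv]
    ring
  have hneg (a b : ℝ) (hab : ¬ (a = 0 ∧ b = 0)) : g (a • u + b • v) (a • u + b • v) < 0 := by
    rw [hcomb]
    by_cases ha : a = 0
    · have hb : 0 < b ^ 2 := by
        have : b ≠ 0 := fun h ↦ hab ⟨ha, h⟩
        positivity
      nlinarith
    · have ha : 0 < a ^ 2 := by positivity
      nlinarith [sq_nonneg b]
  have hzero : g 0 0 = 0 := by simpa using hsmul 0 0 0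
  constructor
  · have hli : LinearIndependent ℝ ![u, v] := by
      rw [LinearIndependent.pair_iff]
      intro a b hab
      by_contra h
      have := hneg a b h
      rw [hab, hzero] at this
      exact lt_irrefl _ this
    have := finrank_span_eq_card hli
    rwa [Matrix.range_cons_cons_empty, Fintype.card_fin] at this
  · intro w hw hw0
    obtain ⟨a, b, rfl⟩ := Submodule.mem_span_pair.1 hw
    refine hneg a b ?_
    rintro ⟨rfl, rfl⟩
    simp at hw0

/-- In an orthogonal sum of an isometrically embedded nondegenerate space and a space of
complementary dimension, every vector decomposes. -/
theorem exists_add_eq_of_orthogonal [FiniteDimensional ℝ T] [FiniteDimensional ℝ V]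
    [FiniteDimensional ℝ W] {g : T → T → ℝ} {G : W → W → ℝ} (τ : T →ₗ[ℝ] W) (ν : V →ₗ[ℝ] W)
    (hdim : Module.finrank ℝ T + Module.finrank ℝ V = Module.finrank ℝ W)
    (hnd : ∀ u, (∀ v, g u v = 0) → u = 0) (hsymm : ∀ a b, G a b = G b a)
    (hG0 : ∀ a, G a 0 = 0) (hiso : ∀ u v, G (τ u) (τ v) = g u v)
    (horth : ∀ u ξ, G (τ u) (ν ξ) = 0)
    (hν : Function.Injective ν) (w : W) : ∃ u ξ, w = τ u + ν ξ := by
  have hτ : Function.Injective τ := by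
    rw [← LinearMap.ker_eq_bot, LinearMap.ker_eq_bot']
    intro u hu
    refine hnd u fun v ↦ ?_
    rw [← hiso, hu, hsymm, hG0]
  have hinf : LinearMap.range τ ⊓ LinearMap.range ν = ⊥ := by
    rw [eq_bot_iff]
    rintro _ ⟨⟨u, rfl⟩, ξ, hξ⟩
    have : u = 0 := hnd u fun v ↦ by rw [← hiso, hsymm, ← hξ, horth]
    simp [this]
  have h := Submodule.finrank_sup_add_finrank_inf_eq (LinearMap.range τ) (LinearMap.range ν)
  rw [hinf, finrank_bot, LinearMap.finrank_range_of_inj hτ, LinearMap.finrank_range_of_inj hν,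
    hdim, add_zero] at h
  have htop := Submodule.eq_top_of_finrank_eq h
  obtain ⟨_, ⟨u, rfl⟩, _, ⟨ξ, rfl⟩, hw⟩ := Submodule.mem_sup.1 (htop ▸ Submodule.mem_top (x := w))
  exact ⟨u, ξ, hw.symm⟩

/-- A skew form on a plane with a nonzero vector in its kernel vanishes. -/
theorem skew_form_eq_zero (hT : Module.finrank ℝ T = 2) {B : T → T → ℝ}
    (hskew : ∀ u v, B u v = - B v u) (hadd : ∀ u v w, B u (v + w) = B u v + B u w)
    (hsmul : ∀ (a : ℝ) u v, B u (a • v) = a * B u v) {u : T} (hu : u ≠ 0)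
    (hker : ∀ v, B u v = 0) (z w : T) : B z w = 0 := by
  have hspan : ∃ v, ∀ z, ∃ a b : ℝ, z = a • u + b • v := by
    obtain ⟨v, hv⟩ : ∃ v, v ∉ Submodule.span ℝ {u} := by
      by_contra! h
      have h1 : Submodule.span ℝ {u} = ⊤ := Submodule.eq_top_iff'.2 h
      have h2 := finrank_span_singleton (K := ℝ) hu
      rw [h1, finrank_top, hT] at h2
      omega
    refine ⟨v, fun z ↦ ?_⟩
    have hli : LinearIndependent ℝ ![u, v] := by
      rw [LinearIndependent.pair_iff' hu]
      intro a ha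
      exact hv (Submodule.mem_span_singleton.2 ⟨a, ha⟩)
    have htop := hli.span_eq_top_of_card_eq_finrank (by simp [hT])
    have hz : z ∈ Submodule.span ℝ {u, v} := by
      have : Set.range ![u, v] = {u, v} := Matrix.range_cons_cons_empty u v _
      rw [← this, htop]
      trivial
    obtain ⟨a, b, h⟩ := Submodule.mem_span_pair.1 hz
    exact ⟨a, b, h.symm⟩
  obtain ⟨v, hv⟩ := hspan
  have hvv : B v v = 0 := by linarith [hskew v v]
  have hvw (w) : B v w = 0 := by
    obtain ⟨a, b, rfl⟩ := hv w
    rw [hadd, hsmul, hsmul, hvv, hskew v u, hker]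
    simp
  obtain ⟨a, b, rfl⟩ := hv z
  rw [hskew, hadd, hsmul, hsmul, hskew w u, hskew w v, hker, hvw]
  simp

/-- A skew-adjoint complex linear endomorphism of a Hermitian space that preserves an
orthogonal splitting into a plane of index one and a complement, and vanishes on the complement,
vanishes on the plane too. -/
theorem skew_eq_zero_of_commute_of_index_one
    (hT : Module.finrank ℝ T = 2) {g : T → T → ℝ} {G : W →ₗ[ℝ] W →ₗ[ℝ] ℝ} {J : W →ₗ[ℝ] W}
    {τ : T →ₗ[ℝ] W} {ν : V →ₗ[ℝ] W} {L : W → W}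
    (hsymm : ∀ a b, G a b = G b a) (hnd : ∀ a, (∀ b, G a b = 0) → a = 0)
    (hJJ : ∀ a, J (J a) = -a) (hJ : ∀ a b, G (J a) (J b) = G a b)
    (hiso : ∀ u v, G (τ u) (τ v) = g u v) (horth : ∀ u ξ, G (τ u) (ν ξ) = 0)
    (hdec : ∀ w, ∃ u ξ, w = τ u + ν ξ)
    (hneg : ∃ u, g u u < 0) (hindex : ∀ u v, g u u < 0 → g v v < 0 → g u v ≠ 0)
    (hskew : ∀ a b, G (L a) b = - G a (L b)) (hcomm : ∀ a, L (J a) = J (L a))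
    (htan : ∀ u, ∃ v, L (τ u) = τ v) (hnor : ∀ ξ η, G (L (ν ξ)) (ν η) = 0) (z w : T) :
    G (L (τ z)) (τ w) = 0 := by
  have hext (a : W) (h1 : ∀ u, G a (τ u) = 0) (h2 : ∀ ξ, G a (ν ξ) = 0) : a = 0 := by
    refine hnd a fun b ↦ ?_
    obtain ⟨u, ξ, rfl⟩ := hdec b
    rw [map_add, h1, h2, add_zero]
  -- Skewness turns the invariance of the tangent plane into invariance of the complement, on which
  -- `L` has no normal part by assumption.
  have hLν (ξ) : L (ν ξ) = 0 := by
    refine hext _ (fun u ↦ ?_) (hnor ξ)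
    obtain ⟨v, hv⟩ := htan u
    rw [hskew, hv, hsymm, horth, neg_zero]
  -- The complement is not a complex line: otherwise `J τ u = τ v` for a negative `u`, with `v` as
  -- negative as `u` and orthogonal to it.
  obtain ⟨ξ, u, η, hξ, hu⟩ : ∃ ξ u η, J (ν ξ) = τ u + ν η ∧ u ≠ 0 := by
    by_contra! hno
    obtain ⟨u, hu⟩ := hneg
    obtain ⟨v, η, hv⟩ := hdec (J (τ u))
    have hη : ν η = 0 := by
      refine hext _ (fun u' ↦ by rw [hsymm, horth]) fun ζ ↦ ?_
      obtain ⟨a, ζ', ha⟩ := hdec (J (ν ζ))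
      have ha0 := hno ζ a ζ' ha
      have h1 : G (J (τ u)) (ν ζ) = 0 := by
        rw [← hJ, hJJ, ha, ha0, map_neg, LinearMap.neg_apply, map_zero, zero_add, horth, neg_zero]
      rwa [hv, map_add, LinearMap.add_apply, horth, zero_add] at h1
    rw [hη, add_zero] at hv
    refine hindex u v hu ?_ ?_
    · rwa [← hiso, ← hv, hJ, hiso]
    · have h1 : G (τ u) (J (τ u)) = - G (τ u) (J (τ u)) := by
        conv_lhs => rw [← hJ, hJJ, map_neg, hsymm]
      rw [← hiso, ← hv]
      linarith
  refine skew_form_eq_zero (B := fun z w ↦ G (L (τ z)) (τ w)) hT ?_ ?_ ?_ hu ?_ z w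
  · intro a b
    rw [hskew, hsymm]
  · intro a b c
    rw [map_add, map_add]
  · intro r a b
    rw [map_smul, map_smul, smul_eq_mul]
  -- `L` kills `τ u = J ν ξ - ν η`. As `L` is not assumed additive, the two terms are paired
  -- separately with `L (τ v)`, by skewness.
  · intro v
    have h1 : τ u = J (ν ξ) - ν η := by rw [hξ, add_sub_cancel_right]
    have h2 : G (J (ν ξ)) (L (τ v)) = 0 := by
      have := hskew (J (ν ξ)) (τ v)
      rw [hcomm, hLν, map_zero, map_zero, LinearMap.zero_apply] at this
      linarith
    have h3 : G (ν η) (L (τ v)) = 0 := by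
      have := hskew (ν η) (τ v)
      rw [hLν, map_zero, LinearMap.zero_apply] at this
      linarith
    rw [hskew, h1, map_sub, LinearMap.sub_apply, h2, h3]
    simp

end PointwiseAlgebra

/-! ### Negative vectors of a Lorentz metric. -/

section IndexOne

variable {E : Type*} [NormedAddCommGroup E] [NormedSpace ℝ E]
  {H : Type*} [TopologicalSpace H] {I : ModelWithCorners ℝ E H}
  {M : Type*} [TopologicalSpace M] [ChartedSpace H M] [IsManifold I ∞ M]
  {g : Π x : M, TangentSpace I x →L[ℝ] TangentSpace I x →L[ℝ] ℝ}

theorem IsLorentzMetric.exists_neg (hg : IsLorentzMetric g) (x : M) : ∃ u, g x u u < 0 := by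
  obtain ⟨W, hW, hd⟩ := (hg.index_one x).1
  have : Nontrivial W := Module.nontrivial_of_finrank_pos (R := ℝ) (by omega)
  obtain ⟨⟨u, hu⟩, hne⟩ := exists_ne (0 : W)
  exact ⟨u, hW u hu fun h ↦ hne (Subtype.ext h)⟩

/-- Two orthogonal negative vectors would span a negative definite plane, which index one forbids.
-/
theorem IsLorentzMetric.ne_zero_of_neg (hg : IsLorentzMetric g) {x : M} {u v : TangentSpace I x}
    (hu : g x u u < 0) (hv : g x v v < 0) : g x u v ≠ 0 := by
  intro huv
  obtain ⟨h2, hW⟩ := negative_definite_span_pair (g := fun u v ↦ g x u v)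
    (fun u v w ↦ by simp) (fun a u v ↦ by simp) (hg.symm x) hu hv huv
  have := (hg.index_one x).2 ⟨_, hW, h2⟩
  omega

end IndexOne

/-! ### Covariant derivatives as connections along the identity. -/

section CovariantDerivativeAlong

variable {E : Type*} [NormedAddCommGroup E] [NormedSpace ℝ E]
  {H : Type*} [TopologicalSpace H] {I : ModelWithCorners ℝ E H}
  {M : Type*} [TopologicalSpace M] [ChartedSpace H M] [IsManifold I ∞ M]
  {F : Type*} [NormedAddCommGroup F] [NormedSpace ℝ F]
  {W : M → Type*} [TopologicalSpace (TotalSpace F W)]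
  [∀ y, AddCommGroup (W y)] [∀ y, Module ℝ (W y)] [∀ y, TopologicalSpace (W y)]
  [∀ y, IsTopologicalAddGroup (W y)] [∀ y, ContinuousSMul ℝ (W y)] [FiberBundle F W]

/-- A smooth connection is a connection along the identity. -/
theorem IsSmoothConnection.isBundleConnectionAlong {nabla : CovariantDerivative I F W}
    (h : IsSmoothConnection nabla) :
    IsBundleConnectionAlong I I F (fun x : M ↦ x) nabla where
  add s t x hs ht := nabla.isCovariantDerivativeOnUniv.add
    (ContMDiffAt.mdifferentiableAt hs (by simp)) (ContMDiffAt.mdifferentiableAt ht (by simp))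
  leibniz φ s x hφ hs u := by
    have := nabla.isCovariantDerivativeOnUniv.leibniz (x := x)
      (ContMDiffAt.mdifferentiableAt hs (by simp)) (hφ.mdifferentiableAt (by simp))
    exact DFunLike.congr_fun this u
  smooth s X x hs hX := h s X x hs hX

end CovariantDerivativeAlong

/-! ### Structure equations and the theorem of Gauss from Codazzi and Ricci. -/

section StructureEquations

variable {M : Type*} [TopologicalSpace M] [ChartedSpace (R 2) M] [IsManifold (𝓡 2) ∞ M]
  {N : Type*} [TopologicalSpace N] [ChartedSpace (R 4) N] [IsManifold (𝓡 4) ∞ N]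
  {V : M → Type*} [TopologicalSpace (TotalSpace (R 2) V)]
  [∀ x, AddCommGroup (V x)] [∀ x, Module ℝ (V x)] [∀ x, TopologicalSpace (V x)]
  [∀ x, IsTopologicalAddGroup (V x)] [∀ x, ContinuousSMul ℝ (V x)]
  [FiberBundle (R 2) V]
  {g : Π x : M, TangentSpace (𝓡 2) x →L[ℝ] TangentSpace (𝓡 2) x →L[ℝ] ℝ}
  {nabla : CovariantDerivative (𝓡 2) (R 2) (TangentSpace (𝓡 2) : M → Type _)}
  {gN : Π y : N, TangentSpace (𝓡 4) y →L[ℝ] TangentSpace (𝓡 4) y →L[ℝ] ℝ}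
  {J : Π y : N, TangentSpace (𝓡 4) y →L[ℝ] TangentSpace (𝓡 4) y}
  {nablaN : CovariantDerivative (𝓡 4) (R 4) (TangentSpace (𝓡 4) : N → Type _)}
  {f : M → N} {τ : Π x : M, TangentSpace (𝓡 2) x →L[ℝ] TangentSpace (𝓡 4) (f x)}
  {ν : Π x : M, V x →L[ℝ] TangentSpace (𝓡 4) (f x)}
  {nab : (Π x : M, TangentSpace (𝓡 4) (f x)) →
    Π x : M, TangentSpace (𝓡 2) x →L[ℝ] TangentSpace (𝓡 4) (f x)}
  {h : Π x : M, TangentSpace (𝓡 2) x →L[ℝ] TangentSpace (𝓡 2) x →L[ℝ] V x}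
  {A : Π x : M, V x →L[ℝ] TangentSpace (𝓡 2) x →L[ℝ] TangentSpace (𝓡 2) x}
  {D : CovariantDerivative (𝓡 2) (R 2) V}

/-- The curvature of a tangent field decomposes into the terms of Gauss and Codazzi. -/
theorem GaussWeingarten.curvatureAlong_tangent
    (hGW : GaussWeingarten nabla f τ ν nab h A D) (hnabla : IsLeviCivita g nabla)
    (hsplit : IsSplitting g gN f τ ν) (hnab : IsConnectionAlong f nab) {x : M}
    (u v z : TangentSpace (𝓡 2) x) :
    curvatureAlong nab (FiberBundle.extend (R 2) u) (FiberBundle.extend (R 2) v)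
        (fun y ↦ τ y (FiberBundle.extend (R 2) z y)) x
      = τ x (curvature nabla x u v z - A x (h x v z) u + A x (h x u z) v)
        + ν x (covDerivSecondForm nabla h D x u v z - covDerivSecondForm nabla h D x v u z) := by
  have hnab' := hnab.isBundleConnectionAlong
  have hZ := eventually_smoothFieldAt_extend z
  have hZx := hZ.self_of_nhds
  have hu := (eventually_smoothFieldAt_extend u).self_of_nhds
  have hv := (eventually_smoothFieldAt_extend v).self_of_nhds
  have key (B : Π y : M, TangentSpace (𝓡 2) y) (hB : SmoothFieldAt B x)
      (a : TangentSpace (𝓡 2) x) :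
      nab (fun y ↦ nab (fun y ↦ τ y (FiberBundle.extend (R 2) z y)) y (B y)) x a
        = (τ x (nabla (fun y ↦ nabla (FiberBundle.extend (R 2) z) y (B y)) x a)
            + ν x (h x a (nabla (FiberBundle.extend (R 2) z) x (B x))))
          + (-τ x (A x (h x (B x) z) a)
            + ν x (D (fun y ↦ h y (B y) (FiberBundle.extend (R 2) z y)) x a)) := by
    have h1 := hnabla.smooth _ B x hZx hB
    have h2 := hGW.smooth_h B _ x hB hZx
    have h3 : SmoothSectionAlongAt (𝓡 2) (𝓡 4) (R 4) f _ x := hsplit.smooth_tangent _ x h1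
    have h4 : SmoothSectionAlongAt (𝓡 2) (𝓡 4) (R 4) f _ x := hsplit.smooth_normal _ x h2
    rw [hnab'.congr (h3.add h4) (hZ.mono fun y hy ↦ hGW.gauss _ y hy (B y)),
      hnab'.add _ _ x h3 h4, add_apply, hGW.gauss _ x h1, hGW.weingarten _ x h2,
      FiberBundle.extend_apply_self]
  -- Writing the bracket as `∇_u v - ∇_v u` turns `h([u, v], z)` into the correction terms of `∇̄h`.
  have htor := hnabla.torsion_free _ _ x hu hv
  rw [curvatureAlong, key _ hv, key _ hu, hGW.gauss _ x hZx, ← htor]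
  simp only [curvature, curvatureField, covDerivSecondForm, FiberBundle.extend_apply_self,
    map_sub, map_add, sub_apply, ← htor]
  abel

/-- The second fundamental form of a torsion free connection is symmetric. -/
theorem GaussWeingarten.second_form_symm
    (hGW : GaussWeingarten nabla f τ ν nab h A D) (hnabla : IsLeviCivita g nabla)
    (hsplit : IsSplitting g gN f τ ν) (hnab : IsKaehlerConnectionAlong gN J f τ nab) {x : M}
    (u v : TangentSpace (𝓡 2) x) : h x u v = h x v u := by
  have hu := (eventually_smoothFieldAt_extend u).self_of_nhds
  have hv := (eventually_smoothFieldAt_extend v).self_of_nhds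
  have h1 := hnab.torsion_free _ _ x hu hv
  rw [hGW.gauss _ x hu, hGW.gauss _ x hv, ← hnabla.torsion_free _ _ x hu hv] at h1
  simp only [FiberBundle.extend_apply_self, map_sub] at h1
  rw [add_sub_add_comm, add_eq_left, sub_eq_zero] at h1
  exact hsplit.injective x h1

variable [VectorBundle ℝ (R 2) V] [ContMDiffVectorBundle ∞ (R 2) V (𝓡 2)]

/-- The normal component of the curvature of a normal field, as in the equation of Ricci. -/
theorem GaussWeingarten.curvatureAlong_normal
    (hGW : GaussWeingarten nabla f τ ν nab h A D) (hsplit : IsSplitting g gN f τ ν)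
    (hnab : IsConnectionAlong f nab) {x : M} (u v : TangentSpace (𝓡 2) x) (ξ : V x) :
    ∃ t, curvatureAlong nab (FiberBundle.extend (R 2) u) (FiberBundle.extend (R 2) v)
        (fun y ↦ ν y (FiberBundle.extend (R 2) ξ y)) x
      = τ x t + ν x (curvature D x u v ξ - h x u (A x ξ v) + h x v (A x ξ u)) := by
  have hnab' := hnab.isBundleConnectionAlong
  have hξ : ∀ᶠ y in 𝓝 x, SmoothSectionAt (𝓡 2) (R 2) (FiberBundle.extend (R 2) ξ) y :=
    eventually_contMDiffAt_extend ξ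
  have hξx := hξ.self_of_nhds
  have hu := (eventually_smoothFieldAt_extend u).self_of_nhds
  have hv := (eventually_smoothFieldAt_extend v).self_of_nhds
  have key (B : Π y : M, TangentSpace (𝓡 2) y) (hB : SmoothFieldAt B x)
      (a : TangentSpace (𝓡 2) x) :
      nab (fun y ↦ nab (fun y ↦ ν y (FiberBundle.extend (R 2) ξ y)) y (B y)) x a
        = -(τ x (nabla (fun y ↦ A y (FiberBundle.extend (R 2) ξ y) (B y)) x a)
            + ν x (h x a (A x ξ (B x))))
          + (-τ x (A x (D (FiberBundle.extend (R 2) ξ) x (B x)) a)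
            + ν x (D (fun y ↦ D (FiberBundle.extend (R 2) ξ) y (B y)) x a)) := by
    have h1 := hGW.smooth_A _ B x hξx hB
    have h2 := hGW.smooth_D _ B x hξx hB
    have h3 : SmoothSectionAlongAt (𝓡 2) (𝓡 4) (R 4) f _ x := hsplit.smooth_tangent _ x h1
    have h4 : SmoothSectionAlongAt (𝓡 2) (𝓡 4) (R 4) f _ x := hsplit.smooth_normal _ x h2
    rw [hnab'.congr (h3.neg.add h4) (hξ.mono fun y hy ↦ hGW.weingarten _ y hy (B y)),
      hnab'.add _ _ x h3.neg h4, add_apply, hnab'.neg h3, neg_apply, hGW.gauss _ x h1,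
      hGW.weingarten _ x h2, FiberBundle.extend_apply_self]
  -- The tangential part is simply what remains; the Ricci equation does not see it.
  refine ⟨-nabla (fun y ↦ A y (FiberBundle.extend (R 2) ξ y) (FiberBundle.extend (R 2) v y)) x u
    + nabla (fun y ↦ A y (FiberBundle.extend (R 2) ξ y) (FiberBundle.extend (R 2) u y)) x v
    - A x (D (FiberBundle.extend (R 2) ξ) x v) u + A x (D (FiberBundle.extend (R 2) ξ) x u) v
    + A x ξ (VectorField.mlieBracket (𝓡 2) (FiberBundle.extend (R 2) u)
      (FiberBundle.extend (R 2) v) x), ?_⟩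
  rw [curvatureAlong, key _ hv, key _ hu, hGW.weingarten _ x hξx]
  simp only [curvature, curvatureField, FiberBundle.extend_apply_self, map_sub, map_add, map_neg]
  abel

/-- The shape operator is adjoint to the second fundamental form. -/
theorem GaussWeingarten.shape_operator
    (hGW : GaussWeingarten nabla f τ ν nab h A D)
    (hg : IsSemiRiemannianMetric g) (hsplit : IsSplitting g gN f τ ν)
    (hnab : IsKaehlerConnectionAlong gN J f τ nab) {x : M} (u v : TangentSpace (𝓡 2) x)
    (ξ : V x) : g x (A x ξ u) v = gN (f x) (ν x (h x u v)) (ν x ξ) := by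
  have hv := (eventually_smoothFieldAt_extend v).self_of_nhds
  have hξ : SmoothSectionAt (𝓡 2) (R 2) (FiberBundle.extend (R 2) ξ) x :=
    (eventually_contMDiffAt_extend ξ).self_of_nhds
  -- Adjointness is the derivative of `⟨τ v, ν ξ⟩ = 0` along `u`.
  have h1 := hnab.metric _ _ x (hsplit.smooth_tangent _ x hv) (hsplit.smooth_normal _ x hξ) u
  simp only [hsplit.orthogonal] at h1
  rw [mvfderiv_const, hGW.gauss _ x hv, hGW.weingarten _ x hξ] at h1
  simp only [FiberBundle.extend_apply_self, map_add, map_neg, add_apply, hsplit.orthogonal,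
    hsplit.isometric, zero_apply] at h1
  rw [hg.symm]
  linarith

/-- For a Kaehler connection along `f`, the equations of Codazzi and Ricci imply that of Gauss. -/
theorem gaussEquationAt_of_codazzi_of_ricci (hg : IsLorentzMetric g)
    (hnabla : IsLeviCivita g nabla) (hN : IsLorentzianKaehler gN J nablaN)
    (hsplit : IsSplitting g gN f τ ν) (hnab : IsKaehlerConnectionAlong gN J f τ nab)
    (hGW : GaussWeingarten nabla f τ ν nab h A D) {x : M}
    (hC : CodazziEquationAt nabla nablaN f τ ν h D x)
    (hR : RicciEquationAt g gN nablaN f τ ν A D x) :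
    GaussEquationAt g nabla gN nablaN f τ ν h x := by
  intro u v z w
  have hf := hsplit.smooth_map
  have hnab' := hnab.toIsConnectionAlong.isBundleConnectionAlong
  have hnabN := hN.levi_civita.smooth.isBundleConnectionAlong
  have hu := eventually_smoothFieldAt_extend u
  have hv := eventually_smoothFieldAt_extend v
  have hτu := eventually_smoothFieldAt_extend (τ x u)
  have hτv := eventually_smoothFieldAt_extend (τ x v)
  have hid : ContMDiff (𝓡 4) (𝓡 4) ∞ (fun y : N ↦ y) := contMDiff_id
  have hshape := hGW.shape_operator hg.toIsSemiRiemannianMetric hsplit hnab (x := x)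
  have hself (ξ : V x) (a b) : g x (A x ξ a) b = g x a (A x ξ b) := by
    rw [hg.symm x a, hshape, hshape, hGW.second_form_symm hnabla hsplit hnab]
  -- `Rh` and `Rt` are the two curvatures as maps of the same space `T_{f x} N`; `L` will be `Rh -
  -- Rt`.
  let Rh (a : TangentSpace (𝓡 4) (f x)) : TangentSpace (𝓡 4) (f x) :=
    curvatureAlong nab (FiberBundle.extend (R 2) u) (FiberBundle.extend (R 2) v)
      (fun y ↦ FiberBundle.extend (R 4) a (f y)) x
  let Rt (a : TangentSpace (𝓡 4) (f x)) : TangentSpace (𝓡 4) (f x) :=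
    curvature nablaN (f x) (τ x u) (τ x v) a
  have hRh_skew (a b) : gN (f x) (Rh a) b = - gN (f x) a (Rh b) :=
    hnab'.bilin_curvatureAlong_extend hf hN.metric.smooth hnab.metric hu.self_of_nhds
      hv.self_of_nhds a b
  -- The curvature of `N` is by definition a curvature along the identity map, so the same lemmas
  -- apply.
  have hRt_skew (a b) : gN (f x) (Rt a) b = - gN (f x) a (Rt b) :=
    hnabN.bilin_curvatureAlong_extend (x := f x) hid hN.metric.smooth hN.levi_civita.metric
      hτu.self_of_nhds hτv.self_of_nhds a b
  have hRh_J (a) : Rh (J (f x) a) = J (f x) (Rh a) :=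
    hnab'.curvatureAlong_extend_endo hf hN.smooth hnab.parallel hu hv a
  have hRt_J (a) : Rt (J (f x) a) = J (f x) (Rt a) :=
    hnabN.curvatureAlong_extend_endo (x := f x) hid hN.smooth hN.parallel hτu hτv a
  -- By tensoriality, extensions on `N` may be exchanged for the tangent and normal fields to which
  -- the formulas of Gauss and Weingarten apply.
  have hRh_eq {s : Π y : M, TangentSpace (𝓡 4) (f y)}
      (hs : ∀ᶠ y in 𝓝 x, SmoothAlongAt f s y) :
      Rh (s x) = curvatureAlong nab (FiberBundle.extend (R 2) u) (FiberBundle.extend (R 2) v) s x :=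
    hnab'.curvatureAlong_pointwise hu hv (eventually_smoothSectionAlongAt_extend hf _) hs
      (by simp)
  have hRh_tan (z) : Rh (τ x z)
      = τ x (curvature nabla x u v z - A x (h x v z) u + A x (h x u z) v)
        + ν x (covDerivSecondForm nabla h D x u v z - covDerivSecondForm nabla h D x v u z) := by
    rw [← hGW.curvatureAlong_tangent hnabla hsplit hnab.toIsConnectionAlong,
      ← hRh_eq ((eventually_smoothFieldAt_extend z).mono fun y hy ↦
        hsplit.smooth_tangent _ y hy), FiberBundle.extend_apply_self]
  have hRh_nor (ξ) : ∃ t, Rh (ν x ξ)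
      = τ x t + ν x (curvature D x u v ξ - h x u (A x ξ v) + h x v (A x ξ u)) := by
    obtain ⟨t, ht⟩ := hGW.curvatureAlong_normal hsplit hnab.toIsConnectionAlong u v ξ
    refine ⟨t, ?_⟩
    rw [← ht, ← hRh_eq ((eventually_contMDiffAt_extend (I' := 𝓡 2) (F := R 2) ξ).mono fun y hy ↦
        hsplit.smooth_normal _ y hy), FiberBundle.extend_apply_self]
  have hT : Module.finrank ℝ (TangentSpace (𝓡 2) x) = 2 :=
    finrank_euclideanSpace_fin (𝕜 := ℝ) (n := 2)
  have hW : Module.finrank ℝ (TangentSpace (𝓡 4) (f x)) = 4 :=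
    finrank_euclideanSpace_fin (𝕜 := ℝ) (n := 4)
  have hV : Module.finrank ℝ (V x) = 2 :=
    (VectorBundle.continuousLinearEquivAt ℝ (R 2) V x).toLinearEquiv.finrank_eq.trans
      (finrank_euclideanSpace_fin (𝕜 := ℝ) (n := 2))
  have : FiniteDimensional ℝ (TangentSpace (𝓡 2) x) := .of_finrank_pos (by omega)
  have : FiniteDimensional ℝ (TangentSpace (𝓡 4) (f x)) := .of_finrank_pos (by omega)
  have : FiniteDimensional ℝ (V x) := .of_finrank_pos (by omega)
  have hdec (a : TangentSpace (𝓡 4) (f x)) : ∃ t ξ, a = τ x t + ν x ξ :=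
    exists_add_eq_of_orthogonal (g := fun a b ↦ g x a b) (G := fun a b ↦ gN (f x) a b)
      (τ x).toLinearMap (ν x).toLinearMap (by omega) (hg.nondegenerate x) (hN.metric.symm _)
      (fun a ↦ map_zero _) (hsplit.isometric x) (hsplit.orthogonal x) (hsplit.injective x) a
  have hzero : gN (f x) (Rh (τ x z) - Rt (τ x z)) (τ x w) = 0 := by
    refine skew_eq_zero_of_commute_of_index_one (g := fun a b ↦ g x a b)
      (G := (ContinuousLinearMap.coeLM ℝ).comp (gN (f x)).toLinearMap) (J := (J (f x)).toLinearMap)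
      (τ := (τ x).toLinearMap) (ν := (ν x).toLinearMap) (L := fun a ↦ Rh a - Rt a)
      hT (hN.metric.symm _) (hN.metric.nondegenerate _) (hN.almost_complex _) (hN.hermitian _)
      (hsplit.isometric x) (hsplit.orthogonal x) hdec (hg.exists_neg x)
      (fun _ _ ↦ hg.ne_zero_of_neg) ?_ ?_ ?_ ?_ z w
    · intro a b
      change gN (f x) (Rh a - Rt a) b = - gN (f x) a (Rh b - Rt b)
      rw [map_sub, map_sub, sub_apply, hRh_skew, hRt_skew]
      ring
    · intro a
      change Rh (J (f x) a) - Rt (J (f x) a) = J (f x) (Rh a - Rt a)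
      rw [hRh_J, hRt_J, map_sub]
    · intro a
      -- By Codazzi the normal parts of the two curvatures cancel.
      obtain ⟨t, ht⟩ := hC u v a
      refine ⟨curvature nabla x u v a - A x (h x v a) u + A x (h x u a) v - t, ?_⟩
      change Rh (τ x a) - Rt (τ x a) = τ x _
      rw [hRh_tan, map_sub (τ x) _ t]
      change _ - curvature nablaN (f x) (τ x u) (τ x v) (τ x a) = _
      rw [ht]
      abel
    · intro ξ η
      -- Since each `A_ξ` is self-adjoint and dual to `h`, the commutator in the Ricci equation
      -- equals the terms in `h` of the normal curvature.
      obtain ⟨t, ht⟩ := hRh_nor ξ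
      have h1 := hR u v ξ η
      change gN (f x) (Rh (ν x ξ) - curvature nablaN (f x) (τ x u) (τ x v) (ν x ξ)) (ν x η) = 0
      rw [ht]
      simp only [map_add, map_sub, add_apply, sub_apply, hsplit.orthogonal, ← hshape] at h1 ⊢
      rw [hself ξ (A x η u), hself η (A x ξ u), hg.symm x (A x ξ u)] at h1
      linarith
  change gN (f x) (Rh (τ x z) - curvature nablaN (f x) (τ x u) (τ x v) (τ x z)) (τ x w) = 0 at hzero
  -- The tangential part of `Rh` holds the curvature of `M` and two shape operator terms; duality
  -- with `h` turns these into the quadratic terms of the Gauss equation.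
  rw [hRh_tan] at hzero
  have hν0 (ξ : V x) : gN (f x) (ν x ξ) (τ x w) = 0 := by rw [hN.metric.symm, hsplit.orthogonal]
  simp only [map_add, map_sub, add_apply, sub_apply, hsplit.isometric, hν0, hshape] at hzero
  rw [hN.metric.symm _ (ν x (h x u z))]
  linarith

end StructureEquations

end LorentzKaehler

open LorentzKaehler in
/-- First part: Lorentz surfaces isometrically immersed by `f` in a Lorentzian Kaehler surface.
Second part: formal solutions, that is, a second fundamental form, a shape operator and a normal
connection that come from an arbitrary Kaehler connection on `f^*TN = TM ⊕ V`, so that none of the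
three equations holds automatically. -/
theorem theorem2
    {M : Type*} [TopologicalSpace M] [ChartedSpace (R 2) M] [IsManifold (𝓡 2) ∞ M]
    {N : Type*} [TopologicalSpace N] [ChartedSpace (R 4) N] [IsManifold (𝓡 4) ∞ N]
    {V : M → Type*} [TopologicalSpace (TotalSpace (R 2) V)]
    [∀ x, AddCommGroup (V x)] [∀ x, Module ℝ (V x)] [∀ x, TopologicalSpace (V x)]
    [∀ x, IsTopologicalAddGroup (V x)] [∀ x, ContinuousSMul ℝ (V x)]
    [FiberBundle (R 2) V] [VectorBundle ℝ (R 2) V] [ContMDiffVectorBundle ∞ (R 2) V (𝓡 2)]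
    (g : Π x : M, TangentSpace (𝓡 2) x →L[ℝ] TangentSpace (𝓡 2) x →L[ℝ] ℝ)
    (nabla : CovariantDerivative (𝓡 2) (R 2) (TangentSpace (𝓡 2) : M → Type _))
    (hg : IsLorentzMetric g) (hnabla : IsLeviCivita g nabla)
    (gN : Π y : N, TangentSpace (𝓡 4) y →L[ℝ] TangentSpace (𝓡 4) y →L[ℝ] ℝ)
    (J : Π y : N, TangentSpace (𝓡 4) y →L[ℝ] TangentSpace (𝓡 4) y)
    (nablaN : CovariantDerivative (𝓡 4) (R 4) (TangentSpace (𝓡 4) : N → Type _))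
    (hN : IsLorentzianKaehler gN J nablaN)
    (f : M → N)
    (ν : Π x : M, V x →L[ℝ] TangentSpace (𝓡 4) (f x))
    (nab : (Π x : M, TangentSpace (𝓡 4) (f x)) →
      Π x : M, TangentSpace (𝓡 2) x →L[ℝ] TangentSpace (𝓡 4) (f x))
    (h : Π x : M, TangentSpace (𝓡 2) x →L[ℝ] TangentSpace (𝓡 2) x →L[ℝ] V x)
    (A : Π x : M, V x →L[ℝ] TangentSpace (𝓡 2) x →L[ℝ] TangentSpace (𝓡 2) x)
    (D : CovariantDerivative (𝓡 2) (R 2) V) :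
    (IsSplitting g gN f (fun x ↦ mfderiv (𝓡 2) (𝓡 4) f x) ν →
      IsPullbackConnection nablaN f nab →
      GaussWeingarten nabla f (fun x ↦ mfderiv (𝓡 2) (𝓡 4) f x) ν nab h A D →
      ∀ x : M,
        CodazziEquationAt nabla nablaN f (fun x ↦ mfderiv (𝓡 2) (𝓡 4) f x) ν h D x →
        RicciEquationAt g gN nablaN f (fun x ↦ mfderiv (𝓡 2) (𝓡 4) f x) ν A D x →
        GaussEquationAt g nabla gN nablaN f (fun x ↦ mfderiv (𝓡 2) (𝓡 4) f x) ν h x) ∧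
    (∀ τ : Π x : M, TangentSpace (𝓡 2) x →L[ℝ] TangentSpace (𝓡 4) (f x),
      IsSplitting g gN f τ ν →
      IsKaehlerConnectionAlong gN J f τ nab →
      GaussWeingarten nabla f τ ν nab h A D →
      ∀ x : M,
        CodazziEquationAt nabla nablaN f τ ν h D x →
        RicciEquationAt g gN nablaN f τ ν A D x →
        GaussEquationAt g nabla gN nablaN f τ ν h x) := by
  have main := fun (τ : Π x : M, TangentSpace (𝓡 2) x →L[ℝ] TangentSpace (𝓡 4) (f x))
      (hsplit : IsSplitting g gN f τ ν) (hnab : IsKaehlerConnectionAlong gN J f τ nab)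
      (hGW : GaussWeingarten nabla f τ ν nab h A D) (x : M)
      (hC : CodazziEquationAt nabla nablaN f τ ν h D x)
      (hR : RicciEquationAt g gN nablaN f τ ν A D x) ↦
    gaussEquationAt_of_codazzi_of_ricci hg hnabla hN hsplit hnab hGW hC hR
  -- An isometric immersion is the case `τ = df`.
  exact ⟨fun hsplit hnab ↦ main _ hsplit
    (hnab.isKaehlerConnectionAlong hsplit.smooth_map hN), main⟩
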